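/- **Setting.** Let $d>T\ge k\ge 1$. There are $T$ source tasks and one target task (index $T+1$). A sample of task $t$ is $(x,y)$ with $x\sim p_t$ on $\mathbb{R}^d$ and $y=x^\top B^*w_t^*+z$, where $z\sim\mathcal N(0,\sigma^2)$ is independent of $x$. Here $B^*\in\mathbb{R}^{d\times k}$ has orthonormal columns, and $W^*=[w_1^*,\dots,w_T^*]\in\mathbb{R}^{k\times T}$ has full row rank $k$. For all $t\in[T+1]$ the law $p_t$ is centred and $\rho^2$-sub-gaussian for some $\rho\ge1$ (that is, $\mathbb{E}e^{s u^\top x}\le e^{s^2\rho^2/2}$ for all $s\in\mathbb R$ and all unit vectors $u$), and $aI\preceq\mathbb{E}_{x\sim p_t}[xx^\top]\preceq bI$ with constants $0<a\le b$. Let $\nu\in\mathbb{R}^T$ be fixed with $W^*\nu=w_{T+1}^*$. **Procedure (A-MTRL).** Draw independent samples, $n_t$ from each source task $t\in[T]$ and $n_{T+1}$ from the target task, and put $N_{tot}=\sum_{t\le T}n_t$. With $X_t,Y_t$ the inputs and labels of task $t$, let $(\hat B,\hat w_1,\dots,\hat w_T)$ minimize the empirical squared loss over all source samples, $\frac1{N_{tot}}\sum_{t\le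 T}\|Y_t-X_tBw_t\|_2^2$, over $B\in\mathbb{R}^{d\times k}$, $w_t\in\mathbb{R}^k$ ($\hat B$ being a measurable function of the source samples), and then let $\hat w_{T+1}$ minimize $\frac1{n_{T+1}}\|Y_{T+1}-X_{T+1}\hat Bw\|_2^2$ over $w\in\mathbb{R}^k$. With $L(B,w)=\mathbb{E}[(y-x^\top Bw)^2]$ for a target sample $(x,y)$, the excess risk is $ER=L(\hat B,\hat w_{T+1})-L(B^*,w_{T+1}^*)$. **Theorem.** 1. (Optimal sampling strategy.) Let $\nu\ne0$, $\underline N>0$ and $N\ge T\underline N$ be real. The problem of minimizing $\sum_t\nu(t)^2/r_t$ over $r\in\mathbb{R}^T$ with $r_t\ge\underline N$ and $\sum_t r_t=N$ has a solution, and $r$ is a solution if and only if $\sum_tr_t=N$ and there is $c'>0$ with $r_t=\max\{c'|\nu(t)|,\underline N\}$ for all $t$. 2. (Sample complexity.) For all $0<a\le b$ there is a constant $C>0$ depending only on $a,b$ such that the following holds for all problems as above, all $\delta\in(0,1)$, all $\varepsilon>0$, all integers $\underline N\ge C\rho^4(d+\ln\frac T\delta)$ with $$\varepsilon^2\le\min\Bigl\{1,\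 \sigma^2(kd+kT)\frac{\|\nu\|_1^2}{T\underline N}\Bigr\},$$ and all $c'>0$. Let $n_t=\max\{c'|\nu(t)|,\underline N\}$, rounded up to an integer, and $Q=\sigma^2(kd+kT)\|\nu\|_1^2\varepsilon^{-2}$. If $$N_{tot}\ \ge\ C\,Q\Bigl(1+\ln\frac Q\delta\Bigr)=\widetilde{\mathcal O}\bigl(\sigma^2(kd+kT)\|\nu\|_1^2\varepsilon^{-2}\bigr),$$ $$n_{T+1}\ \ge\ C\,\sigma^2k\,\varepsilon^{-2}\Bigl(1+\ln\frac1\delta\Bigr)=\widetilde{\mathcal O}\bigl(\sigma^2k\varepsilon^{-2}\bigr)\quad\text{and}\quad n_{T+1}\ge C\rho^4\Bigl(k+\ln\frac1\delta\Bigr),$$ then with probability at least $1-\delta$ the procedure satisfies $ER\le\varepsilon^2$. 3. (Comparison with the $\|\nu\|_2^2\,s^*$ dependence of the $L_2$ strategy.) For a vector $\nu\in\mathbb{R}^T$ and $N\ge T$ put $\|\nu\|_{0,\gamma}=|\{t:|\nu(t)|>\sqrt{\gamma\|\nu\|_2^2/N}\}|$ and $s^*=\inf_{\gamma\in[0,1]}\bigl((1-\gamma)\|\nu\|_{0,\gamma}+\gamma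 T\bigr)$. Then always $\|\nu\|_1^2\le4\,s^*\|\nu\|_2^2$ and $s^*\le T$. The gap can be arbitrarily large: for every $K\in\mathbb{R}$ and $\underline N\in\mathbb{N}$ there are $T$, $\nu\in\mathbb{R}^T\setminus\{0\}$ and $N\ge\max(T,T\underline N)$ with $s^*\|\nu\|_2^2\ge K\|\nu\|_1^2$. -/

import Mathlib

open MeasureTheory ProbabilityTheory Matrix

/-- Data of a linear multi-task problem with inputs in `ℝ^d`, representations in `ℝ^k`,
`T` source tasks and one target task. Vectors of `ℝ^d` are functions `Fin d → ℝ`; only the dot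
product is used on them. -/
structure MTLModel (d k T : ℕ) where
  /-- input law of each source task -/
  p : Fin T → Measure (Fin d → ℝ)
  /-- input law of the target task -/
  pTarget : Measure (Fin d → ℝ)
  /-- ground-truth representation matrix -/
  B : Matrix (Fin d) (Fin k) ℝ
  /-- ground-truth source heads, one per column -/
  W : Matrix (Fin k) (Fin T) ℝ
  /-- ground-truth target head -/
  wTarget : Fin k → ℝ
  /-- noise level: the label noise is `N(0, σ²)` -/
  σ : NNReal

/-- Prediction `(Bᵀ x)ᵀ w` of the linear representation `B` with the head `w`. -/
def predict {d k : ℕ} (B : Matrix (Fin d) (Fin k) ℝ) (w : Fin k → ℝ) (x : Fin d → ℝ) : ℝ :=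
  (Bᵀ *ᵥ x) ⬝ᵥ w

/-- Joint law of `(x, y)` with `x ∼ p`, `z ∼ N(0, σ²)` independent of `x`, and
`y = (Bᵀ x)ᵀ w + z`. -/
noncomputable def taskLaw {d k : ℕ} (p : Measure (Fin d → ℝ)) (B : Matrix (Fin d) (Fin k) ℝ)
    (w : Fin k → ℝ) (σ : NNReal) : Measure ((Fin d → ℝ) × ℝ) :=
  (p.prod (gaussianReal 0 (σ ^ 2))).map (fun q => (q.1, predict B w q.1 + q.2))

/-- Second moment matrix `E[x xᵀ]`. -/
noncomputable def secondMoment {d : ℕ} (p : Measure (Fin d → ℝ)) : Matrix (Fin d) (Fin d) ℝ :=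
  Matrix.of fun i j => ∫ x, x i * x j ∂p

/-- Conditions on one input law: a centred probability law that is `ρ²`-sub-gaussian in every
direction and satisfies `a I ⪯ E[x xᵀ] ⪯ b I`, that is, the singular values of `E[x xᵀ]` lie in
`[a, b]`. -/
structure IsGoodInput {d : ℕ} (a b : ℝ) (ρ : NNReal) (p : Measure (Fin d → ℝ)) : Prop where
  prob : IsProbabilityMeasure p
  centred : ∀ i, ∫ x, x i ∂p = 0
  subgaussian : ∀ u : Fin d → ℝ, u ⬝ᵥ u = 1 →
    HasSubgaussianMGF (fun x => u ⬝ᵥ x) (ρ ^ 2) p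
  lower : (secondMoment p - a • (1 : Matrix (Fin d) (Fin d) ℝ)).PosSemidef
  upper : (b • (1 : Matrix (Fin d) (Fin d) ℝ) - secondMoment p).PosSemidef

/-- Standing assumptions on the model: sub-gaussian inputs with second moments between `a` and `b`
for all source tasks and the target task, orthonormal columns of the ground-truth representation,
and diverse source tasks (`W` has full row rank). -/
structure MTLModel.Admissible {d k T : ℕ} (M : MTLModel d k T) (a b : ℝ) (ρ : NNReal) : Prop where
  source : ∀ t, IsGoodInput a b ρ (M.p t)
  target : IsGoodInput a b ρ M.pTarget
  orthonormal : M.Bᵀ * M.B = 1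
  diverse : M.W.rank = k

/-- Source data sets: `n t` labelled samples from source task `t`. -/
abbrev SourceData (d : ℕ) {T : ℕ} (n : Fin T → ℕ) : Type :=
  (t : Fin T) → Fin (n t) → (Fin d → ℝ) × ℝ

/-- Target data sets: `m` labelled samples. -/
abbrev TargetData (d m : ℕ) : Type := Fin m → (Fin d → ℝ) × ℝ

/-- Joint law of all samples: everything is independent, the samples of each task are i.i.d. -/
noncomputable def MTLModel.dataLaw {d k T : ℕ} (M : MTLModel d k T) (n : Fin T → ℕ) (m : ℕ) :
    Measure (SourceData d n × TargetData d m) :=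
  (Measure.pi fun t => Measure.pi fun _ : Fin (n t) =>
      taskLaw (M.p t) M.B (fun i => M.W i t) M.σ).prod
    (Measure.pi fun _ : Fin m => taskLaw M.pTarget M.B M.wTarget M.σ)

/-- Empirical squared loss over all source samples,
`(1 / N_tot) ∑_t ‖Y_t - X_t B w_t‖²`. -/
noncomputable def sourceLoss {d k T : ℕ} {n : Fin T → ℕ} (S : SourceData d n)
    (q : Matrix (Fin d) (Fin k) ℝ × Matrix (Fin k) (Fin T) ℝ) : ℝ :=
  (1 / (∑ t, n t : ℕ) : ℝ) *
    ∑ t, ∑ j, ((S t j).2 - predict q.1 (fun i => q.2 i t) (S t j).1) ^ 2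

/-- Empirical squared loss of a head on the target samples, `(1 / m) ‖Y - X B w‖²`. -/
noncomputable def targetLoss {d k m : ℕ} (D : TargetData d m) (B : Matrix (Fin d) (Fin k) ℝ)
    (w : Fin k → ℝ) : ℝ :=
  (1 / (m : ℝ)) * ∑ j, ((D j).2 - predict B w (D j).1) ^ 2

/-- `(Bhat, What, what)` is the outcome of the transfer learning process: the representation and
the source heads are computed from the source samples and minimize the source loss over all
`B ∈ ℝ^{d×k}`, `W ∈ ℝ^{k×T}` (on data for which the minimum is not attained they are arbitrary);
then the target head minimizes the target loss with the learned representation kept fixed. -/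
structure IsTransferLearner {d k T : ℕ} (n : Fin T → ℕ) (m : ℕ)
    (Bhat : SourceData d n → Matrix (Fin d) (Fin k) ℝ)
    (What : SourceData d n → Matrix (Fin k) (Fin T) ℝ)
    (what : SourceData d n → TargetData d m → Fin k → ℝ) : Prop where
  measurable_rep : ∀ i j, Measurable fun S => Bhat S i j
  source_min : ∀ S : SourceData d n,
    (∃ q : Matrix (Fin d) (Fin k) ℝ × Matrix (Fin k) (Fin T) ℝ,
      ∀ q' : Matrix (Fin d) (Fin k) ℝ × Matrix (Fin k) (Fin T) ℝ,
        sourceLoss S q ≤ sourceLoss S q') →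
    ∀ q' : Matrix (Fin d) (Fin k) ℝ × Matrix (Fin k) (Fin T) ℝ,
      sourceLoss S (Bhat S, What S) ≤ sourceLoss S q'
  target_min : ∀ (S : SourceData d n) (D : TargetData d m) (w' : Fin k → ℝ),
    targetLoss D (Bhat S) (what S D) ≤ targetLoss D (Bhat S) w'

/-- Population squared loss on the target task. -/
noncomputable def MTLModel.populationLoss {d k T : ℕ} (M : MTLModel d k T)
    (B : Matrix (Fin d) (Fin k) ℝ) (w : Fin k → ℝ) : ℝ :=
  ∫ q, (q.2 - predict B w q.1) ^ 2 ∂(taskLaw M.pTarget M.B M.wTarget M.σ)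

/-- Excess risk on the target task. -/
noncomputable def MTLModel.excessRisk {d k T : ℕ} (M : MTLModel d k T)
    (B : Matrix (Fin d) (Fin k) ℝ) (w : Fin k → ℝ) : ℝ :=
  M.populationLoss B w - M.populationLoss M.B M.wTarget

/-- The `ℓ¹` norm of a vector. -/
def l1norm {T : ℕ} (ν : Fin T → ℝ) : ℝ := ∑ t, |ν t|

/-- The sampling rule `n_t = max {c |ν(t)|, Nmin}`, rounded up to an integer. -/
noncomputable def sampleRule {T : ℕ} (ν : Fin T → ℝ) (c : ℝ) (Nmin : ℕ) (t : Fin T) : ℕ :=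
  max ⌈c * |ν t|⌉₊ Nmin

/-- `r` is an optimal (real-valued) allocation for the relevance vector `ν`, total budget `N` and
minimum `Nmin` per task: it minimizes `∑_t ν(t)² / r_t` subject to `r_t ≥ Nmin`, `∑_t r_t = N`. -/
def IsOptimalAllocation {T : ℕ} (ν : Fin T → ℝ) (Nmin N : ℝ) (r : Fin T → ℝ) : Prop :=
  (∀ t, Nmin ≤ r t) ∧ ∑ t, r t = N ∧
    ∀ r' : Fin T → ℝ, (∀ t, Nmin ≤ r' t) → ∑ t, r' t = N →
      ∑ t, ν t ^ 2 / r t ≤ ∑ t, ν t ^ 2 / r' t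

open Classical in
/-- `‖ν‖_{0,γ}`, the number of `t` with `|ν(t)| > √(γ ‖ν‖₂² / N)`. -/
noncomputable def approxSupportSize {T : ℕ} (ν : Fin T → ℝ) (N γ : ℝ) : ℕ :=
  (Finset.univ.filter fun t => √(γ * (∑ s, ν s ^ 2) / N) < |ν t|).card

/-- `s* = min_{γ ∈ [0,1]} (1 - γ) ‖ν‖_{0,γ} + γ T`. -/
noncomputable def approxSparsity {T : ℕ} (ν : Fin T → ℝ) (N : ℝ) : ℝ :=
  sInf ((fun γ : ℝ => (1 - γ) * (approxSupportSize ν N γ : ℝ) + γ * T) '' Set.Icc 0 1)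

/-- The leading source sample size `σ² (k d + k T) ‖ν‖₁² / ε²`. -/
noncomputable def sourceSize (d k : ℕ) {T : ℕ} (σ : ℝ) (ν : Fin T → ℝ) (ε : ℝ) : ℝ :=
  σ ^ 2 * (k * d + k * T) * l1norm ν ^ 2 / ε ^ 2

/-! Allocation. The objective is convex and the budget constraint linear, so `max (c * |ν t|) Nmin`
is the water-filling (KKT) point with multiplier `1 / c ^ 2`. Summing the tangent-line bound
`div_sq_tangent` gives optimality, its equality case gives uniqueness, and continuity in `c` meets
the budget.

Sample complexity. Let `v t` and `θ t` be the true and learned predictors of source task `t`. All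
errors `θ t - v t` lie in one subspace of dimension at most `2k`, and the empirical loss at `θ` is
at most that at `v`. On a favourable event every source design is well conditioned on `ℝ^d`, and the
noise, normalized by `√n_t`, is an operator `ℝ^d → ℝ^T` with squared norm of order `σ² (d + T + log
(1/δ))`. Hence `source_error_le` bounds `∑ n_t ‖θ t - v t‖²` by order `σ² k (d + T + log (1/δ))`.
The subspace depends on the data, but the operator bound is uniform, so it enters only through an
orthonormal basis of it. Because `W ν` is the target head, the learned representation with head
`What ν` has error `∑ ν(t) (θ t - v t)`. Weighted Cauchy–Schwarz (`combination_sq_le`) bounds its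
square by `∑ ν(t)² / n_t` times the weighted source error, and the sampling rule makes that factor
at most `2 ‖ν‖₁² / N_tot` (`sum_sq_div_sampleRule_le`). The target regression, compared with this
head (`target_error_le`), lives in a space of dimension at most `k + 1` that is fixed once the
source data are given, which costs a further `σ² (k + log (1/δ)) / m`. The designs are controlled by
Chernoff bounds on a net of the sphere (`exists_goodDesign_const`), the noise by a self-normalized
exponential identity averaged over a Gaussian parameter (`lintegral_exp_sq_le_of_self_normalized`).

Sparsity. The upper bound splits `ν` at the threshold defining `‖ν‖_{0,γ}`; the gap comes from one
entry `1` and many tiny ones that all exceed the threshold once `N` is large. -/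

/-! ### Optimal allocation -/

/-- Tangent-line bound for `x² / r` at the water-filling allocation. -/
lemma div_sq_tangent {x c m r : ℝ} (hc : 0 < c) (hm : 0 < m) (hr : m ≤ r) :
    x ^ 2 / max (c * |x|) m - (r - max (c * |x|) m) / c ^ 2 ≤ x ^ 2 / r ∧
    (x ^ 2 / max (c * |x|) m - (r - max (c * |x|) m) / c ^ 2 = x ^ 2 / r →
      r = max (c * |x|) m) := by
  have hr0 : 0 < r := hm.trans_le hr
  rw [← sq_abs x]
  generalize hy : |x| = y
  have hy0 : 0 ≤ y := hy ▸ abs_nonneg x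
  set s := max (c * y) m with hs
  have hsm : m ≤ s := le_max_right _ _
  have hs0 : 0 < s := hm.trans_le hsm
  -- The first term is the complementary-slackness term of the Lagrangian, the second the exact
  -- convexity remainder of `1 / r`; both turn out to be nonnegative.
  have key : y ^ 2 / r - (y ^ 2 / s - (r - s) / c ^ 2) =
      (r - s) * (1 / c ^ 2 - y ^ 2 / s ^ 2) + y ^ 2 * (r - s) ^ 2 / (r * s ^ 2) := by
    field_simp
    ring
  have h1 : 0 ≤ (r - s) * (1 / c ^ 2 - y ^ 2 / s ^ 2) := by
    rcases le_total (c * y) m with h | h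
    · have hsm' : s = m := max_eq_right h
      refine mul_nonneg (by linarith) ?_
      rw [sub_nonneg, div_le_div_iff₀ (by positivity) (by positivity), hsm', one_mul, ← mul_pow]
      exact pow_le_pow_left₀ (by positivity) (by linarith) 2
    · have hsm' : s = c * y := max_eq_left h
      have : 1 / c ^ 2 - y ^ 2 / s ^ 2 = 0 := by
        have hy' : y ≠ 0 := by
          rintro rfl
          simp at h
          linarith
        rw [hsm']
        field_simp
        ring
      rw [this, mul_zero]
  have h2 : 0 ≤ y ^ 2 * (r - s) ^ 2 / (r * s ^ 2) := by positivity
  refine ⟨by linarith, fun h => ?_⟩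
  have h1' : (r - s) * (1 / c ^ 2 - y ^ 2 / s ^ 2) = 0 := by linarith
  have h2' : y ^ 2 * (r - s) ^ 2 / (r * s ^ 2) = 0 := by linarith
  have h3 : y ^ 2 * (r - s) ^ 2 = 0 := by
    have : r * s ^ 2 ≠ 0 := by positivity
    field_simp at h2'
    linarith
  -- For `y = 0` the convexity remainder carries no information, and the slackness term, with
  -- coefficient `1 / c ^ 2`, forces `r = s` instead.
  rcases mul_eq_zero.mp h3 with h4 | h4
  · have hy' : y = 0 := by simpa using h4
    have h5 : 1 / c ^ 2 - y ^ 2 / s ^ 2 ≠ 0 := by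
      rw [hy']
      simp [hc.ne']
    have := (mul_eq_zero.mp h1').resolve_right h5
    linarith
  · have : r - s = 0 := by simpa using h4
    linarith

/-- Intermediate value theorem in `c`: at `Nmin / ‖ν‖₁` every maximum equals `Nmin`, while for `c ≥
N / |ν t₀|` a single summand already reaches `N`. -/
lemma exists_sum_max_eq {T : ℕ} {ν : Fin T → ℝ} (hν : ν ≠ 0) {Nmin N : ℝ} (h0 : 0 < Nmin)
    (hN : T * Nmin ≤ N) : ∃ c : ℝ, 0 < c ∧ ∑ t, max (c * |ν t|) Nmin = N := by
  obtain ⟨t₀, ht₀⟩ := Function.ne_iff.mp hν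
  have hpos : 0 < |ν t₀| := abs_pos.mpr ht₀
  have hN0 : 0 ≤ N := le_trans (by positivity) hN
  let f : ℝ → ℝ := fun c => ∑ t, max (c * |ν t|) Nmin
  have hf : Continuous f := by fun_prop
  let M := ∑ t, |ν t|
  have hM : 0 < M := hpos.trans_le
    (Finset.single_le_sum (f := fun t => |ν t|) (fun t _ => abs_nonneg _) (Finset.mem_univ t₀))
  let c₀ := Nmin / M
  have hc₀ : 0 < c₀ := by positivity
  have hl : f c₀ ≤ N := by
    refine le_trans (le_of_eq ?_) hN
    have : ∀ t, max (c₀ * |ν t|) Nmin = Nmin := fun t => max_eq_right (by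
      have : |ν t| ≤ M :=
        Finset.single_le_sum (f := fun t => |ν t|) (fun t _ => abs_nonneg _) (Finset.mem_univ t)
      calc c₀ * |ν t| ≤ c₀ * M := by gcongr
        _ = Nmin := by simp only [c₀]; field_simp)
    simp [f, this]
  let c₁ := max c₀ (N / |ν t₀|)
  have hu : N ≤ f c₁ := by
    calc N = N / |ν t₀| * |ν t₀| := by field_simp
      _ ≤ c₁ * |ν t₀| := by gcongr; exact le_max_right _ _
      _ ≤ max (c₁ * |ν t₀|) Nmin := le_max_left _ _
      _ ≤ f c₁ := Finset.single_le_sum (f := fun t => max (c₁ * |ν t|) Nmin)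
          (fun t _ => h0.le.trans (le_max_right _ _)) (Finset.mem_univ t₀)
  obtain ⟨c, hc, hfc⟩ := intermediate_value_Icc (le_max_left _ _ : c₀ ≤ c₁) hf.continuousOn ⟨hl, hu⟩
  exact ⟨c, hc₀.trans_le hc.1, hfc⟩

/-- In the sum of the tangent-line bounds the linear terms cancel, since both allocations use the
whole budget `N`. -/
lemma isOptimalAllocation_max {T : ℕ} {ν : Fin T → ℝ} {Nmin N c : ℝ} (h0 : 0 < Nmin) (hc : 0 < c)
    (hs : ∑ t, max (c * |ν t|) Nmin = N) :
    IsOptimalAllocation ν Nmin N (fun t => max (c * |ν t|) Nmin) ∧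
    ∀ r, IsOptimalAllocation ν Nmin N r → r = fun t => max (c * |ν t|) Nmin := by
  have hsum : ∀ r : Fin T → ℝ, ∑ t, r t = N →
      ∑ t, (ν t ^ 2 / max (c * |ν t|) Nmin - (r t - max (c * |ν t|) Nmin) / c ^ 2) =
      ∑ t, ν t ^ 2 / max (c * |ν t|) Nmin := by
    intro r hr
    rw [Finset.sum_sub_distrib, ← Finset.sum_div, Finset.sum_sub_distrib, hr, hs]
    simp
  refine ⟨⟨fun t => le_max_right _ _, hs, fun r hr hrN => ?_⟩, fun r ⟨hr, hrN, hopt⟩ => ?_⟩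
  · rw [← hsum r hrN]
    exact Finset.sum_le_sum fun t _ => (div_sq_tangent hc h0 (hr t)).1
  · have h1 := hopt _ (fun t => le_max_right (c * |ν t|) Nmin) hs
    rw [← hsum r hrN] at h1
    have h2 := (Finset.sum_eq_sum_iff_of_le
      (fun t _ => (div_sq_tangent (x := ν t) hc h0 (hr t)).1)).mp
      (le_antisymm (Finset.sum_le_sum fun t _ => (div_sq_tangent hc h0 (hr t)).1) h1)
    funext t
    exact (div_sq_tangent hc h0 (hr t)).2 (h2 t (Finset.mem_univ t))

theorem optimalAllocation_characterization (T : ℕ) (ν : Fin T → ℝ) (hν : ν ≠ 0) (Nmin N : ℝ)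
    (h0 : 0 < Nmin) (hN : T * Nmin ≤ N) :
    (∃ r, IsOptimalAllocation ν Nmin N r) ∧
      ∀ r, IsOptimalAllocation ν Nmin N r ↔
        ∃ c : ℝ, 0 < c ∧ (∀ t, r t = max (c * |ν t|) Nmin) ∧ ∑ t, r t = N := by
  obtain ⟨c, hc, hs⟩ := exists_sum_max_eq hν h0 hN
  obtain ⟨h1, h2⟩ := isOptimalAllocation_max h0 hc hs
  refine ⟨⟨_, h1⟩, fun r => ⟨fun hr => ?_, ?_⟩⟩
  · have := h2 r hr
    exact ⟨c, hc, fun t => congrFun this t, hr.2.1⟩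
  · rintro ⟨c', hc', hr, hrN⟩
    obtain rfl : r = fun t => max (c' * |ν t|) Nmin := funext hr
    exact (isOptimalAllocation_max h0 hc' hrN).1

/-! ### Approximate sparsity -/

lemma l1norm_sq_le_card_mul {T : ℕ} (ν : Fin T → ℝ) (s : Finset (Fin T)) :
    (∑ t ∈ s, |ν t|) ^ 2 ≤ s.card * ∑ t, ν t ^ 2 := by
  refine (sq_sum_le_card_mul_sum_sq).trans ?_
  simp only [sq_abs]
  exact mul_le_mul_of_nonneg_left (Finset.sum_le_sum_of_subset_of_nonneg (Finset.subset_univ s)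
    fun _ _ _ => sq_nonneg _) (Nat.cast_nonneg _)

/-- For `γ ≥ 1/2` the term `γ T` alone suffices. For `γ ≤ 1/2`, Cauchy–Schwarz on the large entries
gives `‖ν‖_{0,γ} ‖ν‖₂²`, and the small ones contribute at most `T² γ ‖ν‖₂² / N ≤ γ T ‖ν‖₂²`. The
factor `4` absorbs the squared sum and `1 ≤ 2 (1 - γ)`. -/
lemma l1norm_sq_le_of_gamma {T : ℕ} (ν : Fin T → ℝ) {N γ : ℝ} (hN : T ≤ N)
    (h0 : 0 ≤ γ) (h1 : γ ≤ 1) :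
    l1norm ν ^ 2 ≤ 4 * (((1 - γ) * (approxSupportSize ν N γ : ℝ) + γ * T) * ∑ t, ν t ^ 2) := by
  classical
  set V := ∑ t, ν t ^ 2 with hV
  have hV0 : 0 ≤ V := Finset.sum_nonneg fun _ _ => sq_nonneg _
  have hall := l1norm_sq_le_card_mul ν Finset.univ
  simp only [Finset.card_univ, Fintype.card_fin] at hall
  rcases Nat.eq_zero_or_pos T with rfl | hT
  · simp [l1norm, hV]
  have hT' : (0 : ℝ) < T := by exact_mod_cast hT
  set m := approxSupportSize ν N γ with hm
  have hmT : 0 ≤ (1 - γ) * (m : ℝ) := mul_nonneg (by linarith) (by positivity)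
  rcases le_total (1 / 2) γ with hγ | hγ
  · calc l1norm ν ^ 2 ≤ T * V := hall
      _ ≤ 4 * ((γ * T) * V) := by nlinarith [mul_nonneg hT'.le hV0]
      _ ≤ _ := by gcongr; linarith
  · set th := √(γ * V / N) with hth
    set big := Finset.univ.filter fun t => th < |ν t| with hbig
    have hmb : (m : ℝ) = big.card := by
      simp only [hm, approxSupportSize, hbig, hth, hV]
    have hsplit : l1norm ν = ∑ t ∈ big, |ν t| + ∑ t ∈ bigᶜ, |ν t| :=
      (Finset.sum_add_sum_compl big _).symm
    have hb := l1norm_sq_le_card_mul ν big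
    have hsm : ∑ t ∈ bigᶜ, |ν t| ≤ T * th := by
      calc ∑ t ∈ bigᶜ, |ν t| ≤ ∑ t ∈ bigᶜ, th := Finset.sum_le_sum fun t ht => by
            simpa [hbig] using ht
        _ = bigᶜ.card * th := by simp
        _ ≤ T * th := by
            gcongr
            simpa using Finset.card_le_univ bigᶜ
    have hsm2 : (∑ t ∈ bigᶜ, |ν t|) ^ 2 ≤ γ * T * V := by
      calc (∑ t ∈ bigᶜ, |ν t|) ^ 2 ≤ (T * th) ^ 2 :=
            pow_le_pow_left₀ (Finset.sum_nonneg fun _ _ => abs_nonneg _) hsm 2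
        _ = T ^ 2 * (γ * V / N) := by
            rw [mul_pow, hth, Real.sq_sqrt]
            exact div_nonneg (by positivity) (hT'.le.trans hN)
        _ ≤ T ^ 2 * (γ * V / T) := by gcongr
        _ = γ * T * V := by field_simp
    rw [← hmb] at hb
    have hmV : 0 ≤ (m : ℝ) * V := by positivity
    calc l1norm ν ^ 2 ≤ 2 * ((∑ t ∈ big, |ν t|) ^ 2 + (∑ t ∈ bigᶜ, |ν t|) ^ 2) := by
          rw [hsplit]; exact add_sq_le
      _ ≤ 2 * (m * V + γ * T * V) := by gcongr
      _ ≤ _ := by nlinarith [mul_nonneg (mul_nonneg h0 hT'.le) hV0]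

theorem l1norm_sq_le_approxSparsity (T : ℕ) (ν : Fin T → ℝ) (N : ℝ) (hN : T ≤ N) :
    l1norm ν ^ 2 ≤ 4 * (approxSparsity ν N * ∑ t, ν t ^ 2) ∧ approxSparsity ν N ≤ T := by
  set V := ∑ t, ν t ^ 2 with hV
  have hV0 : 0 ≤ V := Finset.sum_nonneg fun _ _ => sq_nonneg _
  constructor
  · rcases hV0.eq_or_lt with h | h
    · have := l1norm_sq_le_of_gamma ν hN le_rfl zero_le_one
      rw [← hV, ← h] at this
      rw [← h]
      simpa using this
    · have : l1norm ν ^ 2 / (4 * V) ≤ approxSparsity ν N := by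
        refine le_csInf ⟨_, 0, by simp, rfl⟩ ?_
        rintro _ ⟨γ, ⟨h0, h1⟩, rfl⟩
        rw [div_le_iff₀ (by positivity)]
        have := l1norm_sq_le_of_gamma ν hN h0 h1
        linarith
      rw [div_le_iff₀ (by positivity)] at this
      linarith
  · refine csInf_le ⟨0, ?_⟩ ⟨1, by simp, by simp⟩
    rintro _ ⟨γ, ⟨h0, h1⟩, rfl⟩
    have : 0 ≤ 1 - γ := by linarith
    positivity

theorem exists_approxSparsity_gap (K : ℝ) (Nmin : ℕ) :
    ∃ (T : ℕ) (ν : Fin T → ℝ) (N : ℝ), ν ≠ 0 ∧ T ≤ N ∧ T * Nmin ≤ N ∧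
      K * l1norm ν ^ 2 ≤ approxSparsity ν N * ∑ t, ν t ^ 2 := by
  classical
  set T' : ℕ := ⌈4 * |K|⌉₊ with hT'
  have hK : 4 * |K| ≤ T' := Nat.le_ceil _
  set x : ℝ := 1 / (T' + 1) with hx
  have hx0 : 0 < x := by positivity
  -- One dominant entry keeps both norms of order one: `‖ν‖₁ ≤ 2` and `‖ν‖₂ ≥ 1`.
  let ν : Fin (T' + 1) → ℝ := Fin.cons 1 fun _ => x
  set V := ∑ t, ν t ^ 2 with hV
  have hVeq : V = 1 + T' * x ^ 2 := by simp [hV, Fin.sum_univ_succ, ν]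
  have hV1 : 1 ≤ V := by rw [hVeq]; nlinarith [mul_nonneg (Nat.cast_nonneg (α := ℝ) T') (sq_nonneg x)]
  have hl1 : l1norm ν = 1 + T' * x := by simp [l1norm, Fin.sum_univ_succ, ν, abs_of_pos hx0]
  have hl2 : l1norm ν ≤ 2 := by
    rw [hl1, hx, mul_one_div]
    have : (T' : ℝ) / (T' + 1) ≤ 1 := by rw [div_le_one (by positivity)]; linarith
    linarith
  have hl0 : 0 ≤ l1norm ν := Finset.sum_nonneg fun _ _ => abs_nonneg _
  have hmin : ∀ t, x ≤ |ν t| := by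
    intro t
    refine Fin.cases ?_ (fun i => ?_) t
    · simp only [ν, Fin.cons_zero, abs_one, hx]
      rw [div_le_one (by positivity)]
      linarith [Nat.cast_nonneg (α := ℝ) T']
    · simp [ν, abs_of_pos hx0]
  -- The second summand makes the threshold at `γ = 1` at most `x / 2`, so for every `γ` all `T' +
  -- 1` entries count and `s*` is at least `T' + 1`.
  set N : ℝ := (T' + 1) * (Nmin + 1) + 4 * V / x ^ 2 with hN
  have hVx : 0 < 4 * V / x ^ 2 := by positivity
  have hN1 : 4 * V / x ^ 2 ≤ N := by rw [hN]; linarith [show 0 ≤ ((T' : ℝ) + 1) * (Nmin + 1) by positivity]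
  have hN0 : 0 < N := hVx.trans_le hN1
  have hthr : V / N ≤ x ^ 2 / 4 := by
    rw [div_le_iff₀ (by positivity)] at hN1
    rw [div_le_iff₀ hN0]
    linarith
  have hsupp : ∀ γ ∈ Set.Icc (0 : ℝ) 1, approxSupportSize ν N γ = T' + 1 := by
    rintro γ ⟨h0, h1⟩
    unfold approxSupportSize
    rw [Finset.filter_true_of_mem]
    · simp
    · intro t _
      refine lt_of_lt_of_le ?_ (hmin t)
      rw [← hV, Real.sqrt_lt' hx0, mul_div_assoc]
      have : 0 ≤ V / N := by positivity
      nlinarith [sq_pos_of_pos hx0]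
  refine ⟨T' + 1, ν, N, fun h => ?_, ?_, ?_, ?_⟩
  · simpa [ν] using congrFun h 0
  · push_cast
    nlinarith [mul_nonneg (show 0 ≤ (T' : ℝ) + 1 by positivity) (Nat.cast_nonneg (α := ℝ) Nmin)]
  · push_cast
    nlinarith [Nat.cast_nonneg (α := ℝ) T']
  · have hs : ((T' + 1 : ℕ) : ℝ) ≤ approxSparsity ν N := by
      refine le_csInf ⟨_, 0, by simp, rfl⟩ ?_
      rintro _ ⟨γ, hγ, rfl⟩
      simp only [hsupp γ hγ]
      linarith
    push_cast at hs
    have hl4 : l1norm ν ^ 2 ≤ 4 := by nlinarith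
    calc K * l1norm ν ^ 2 ≤ |K| * l1norm ν ^ 2 := by gcongr; exact le_abs_self K
      _ ≤ |K| * 4 := by gcongr
      _ ≤ approxSparsity ν N := by linarith
      _ ≤ approxSparsity ν N * V := le_mul_of_one_le_right (by linarith [Nat.cast_nonneg (α := ℝ) T']) hV1

/-! ### Nets of the unit sphere -/

section Net

open Metric Module

variable {E : Type*} [NormedAddCommGroup E] [NormedSpace ℝ E] [FiniteDimensional ℝ E]

/-- Volume bound for separated subsets of the unit sphere. -/
lemma card_le_of_separated_sphere {η : ℝ} (hη : 0 < η) (hη1 : η ≤ 1) (s : Finset E)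
    (hs : ∀ c ∈ s, ‖c‖ ≤ 1) (h : ∀ c ∈ s, ∀ d ∈ s, c ≠ d → η ≤ ‖c - d‖) :
    (s.card : ℝ) ≤ (3 / η) ^ finrank ℝ E := by
  borelize E
  let μ : Measure E := Measure.addHaar
  let δ : ℝ := η / 2
  let ρ : ℝ := 3 / 2
  have δpos : 0 < δ := by positivity
  have ρpos : 0 < ρ := by norm_num
  set A := ⋃ c ∈ s, ball (c : E) δ with hA
  have D : Set.Pairwise (s : Set E) (Function.onFun Disjoint fun c => ball (c : E) δ) := by
    rintro c hc d hd hcd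
    apply ball_disjoint_ball
    rw [dist_eq_norm]
    convert! h c hc d hd hcd
    simp only [δ]
    ring
  have A_subset : A ⊆ ball (0 : E) ρ := by
    refine Set.iUnion₂_subset fun x hx => ?_
    apply ball_subset_ball'
    rw [dist_zero_right]
    have := hs x hx
    simp only [δ, ρ]
    linarith
  have I : (s.card : ENNReal) * ENNReal.ofReal (δ ^ finrank ℝ E) * μ (ball 0 1) ≤
      ENNReal.ofReal (ρ ^ finrank ℝ E) * μ (ball 0 1) :=
    calc
      (s.card : ENNReal) * ENNReal.ofReal (δ ^ finrank ℝ E) * μ (ball 0 1) = μ A := by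
        rw [hA, measure_biUnion_finset D fun c _ => measurableSet_ball]
        simp only [μ.addHaar_ball_of_pos _ δpos]
        simp only [Finset.sum_const, nsmul_eq_mul, mul_assoc]
      _ ≤ μ (ball (0 : E) ρ) := measure_mono A_subset
      _ = ENNReal.ofReal (ρ ^ finrank ℝ E) * μ (ball 0 1) := by
        simp only [μ.addHaar_ball_of_pos _ ρpos]
  have J : (s.card : ENNReal) * ENNReal.ofReal (δ ^ finrank ℝ E) ≤
      ENNReal.ofReal (ρ ^ finrank ℝ E) :=
    (ENNReal.mul_le_mul_iff_left (measure_ball_pos _ _ zero_lt_one).ne' measure_ball_lt_top.ne).1 I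
  have K := ENNReal.toReal_le_of_le_ofReal (pow_nonneg ρpos.le _) J
  rw [ENNReal.toReal_mul, ENNReal.toReal_natCast,
    ENNReal.toReal_ofReal (pow_nonneg δpos.le _)] at K
  rw [show 3 / η = ρ / δ by simp only [ρ, δ]; field_simp, div_pow, le_div_iff₀ (by positivity)]
  exact K

/-- A covering number is at most the corresponding packing number, and the volume bound limits every
finite separated family; an infinite or too large family would contain one with `n + 1` points. -/
lemma exists_finset_net_sphere {η : ℝ} (hη : 0 < η) (hη1 : η ≤ 1) :
    ∃ N : Finset E, (N.card : ℝ) ≤ (3 / η) ^ finrank ℝ E ∧ (∀ y ∈ N, ‖y‖ = 1) ∧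
      ∀ u : E, ‖u‖ = 1 → ∃ y ∈ N, ‖u - y‖ ≤ η := by
  set n : ℕ := ⌊(3 / η) ^ finrank ℝ E⌋₊ with hn
  have hle : packingNumber η.toNNReal (sphere (0 : E) 1) ≤ n := by
    refine iSup_le fun C => iSup_le fun hC => iSup_le fun hsep => ?_
    by_contra! hlt
    obtain ⟨t, htC, ht⟩ := Set.exists_subset_encard_eq (Order.add_one_le_of_lt hlt)
    have htfin : t.Finite := Set.finite_of_encard_eq_coe (k := n + 1) (by rw [ht]; rfl)
    have hcard := card_le_of_separated_sphere hη hη1 htfin.toFinset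
      (fun c hc => by simpa using (hC (htC (htfin.mem_toFinset.mp hc))).le)
      (fun c hc d hd hcd => by
        have := hsep (htC (htfin.mem_toFinset.mp hc)) (htC (htfin.mem_toFinset.mp hd)) hcd
        have h2 : ENNReal.ofReal η < edist c d := this
        rw [edist_dist, dist_eq_norm] at h2
        exact ((ENNReal.ofReal_lt_ofReal_iff_of_nonneg hη.le).mp h2).le)
    have h3 : htfin.toFinset.card ≤ n := Nat.le_floor hcard
    rw [htfin.encard_eq_coe_toFinset_card] at ht
    have : htfin.toFinset.card = n + 1 := by exact_mod_cast ht
    omega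
  have hcov := (coveringNumber_le_packingNumber η.toNNReal (sphere (0 : E) 1)).trans hle
  obtain ⟨C, hCs, hCf, hCc, hCe⟩ := exists_set_encard_eq_coveringNumber
    (ne_top_of_le_ne_top (ENat.natCast_ne_top n) hcov)
  refine ⟨hCf.toFinset, ?_, fun y hy => by simpa using hCs (hCf.mem_toFinset.mp hy), fun u hu => ?_⟩
  · rw [← hCe, hCf.encard_eq_coe_toFinset_card] at hcov
    have : hCf.toFinset.card ≤ n := by exact_mod_cast hcov
    exact (Nat.cast_le.mpr this).trans (Nat.floor_le (by positivity))
  · obtain ⟨y, hy, hd⟩ := hCc (show u ∈ sphere (0 : E) 1 by simpa using hu)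
    refine ⟨y, hCf.mem_toFinset.mpr hy, ?_⟩
    have h2 : edist u y ≤ η.toNNReal := hd
    rw [edist_dist, dist_eq_norm] at h2
    exact (ENNReal.ofReal_le_ofReal_iff hη.le).mp h2

variable {F : Type*} [NormedAddCommGroup F] [NormedSpace ℝ F]

-- Moving a unit vector to the net costs at most `‖A‖ / 2`, which is absorbed on the left.
omit [FiniteDimensional ℝ E] in
lemma opNorm_le_of_net {η M : ℝ} (hη1 : η ≤ 1 / 2) (hM : 0 ≤ M) (N : Finset E)
    (hN : ∀ u : E, ‖u‖ = 1 → ∃ y ∈ N, ‖u - y‖ ≤ η) (A : E →L[ℝ] F)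
    (hA : ∀ y ∈ N, ‖A y‖ ≤ M) : ‖A‖ ≤ 2 * M := by
  have : ‖A‖ ≤ M + ‖A‖ * (1 / 2) := by
    refine A.opNorm_le_of_unit_norm (by positivity) fun u hu => ?_
    obtain ⟨y, hy, hd⟩ := hN u hu
    calc ‖A u‖ = ‖A y + A (u - y)‖ := by rw [← map_add]; simp
      _ ≤ ‖A y‖ + ‖A (u - y)‖ := norm_add_le _ _
      _ ≤ M + ‖A‖ * (1 / 2) := by
        gcongr
        · exact hA y hy
        · exact (A.le_opNorm _).trans (by gcongr; exact hd.trans hη1)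
  linarith

omit [FiniteDimensional ℝ E] in
lemma le_norm_of_net {η M m : ℝ} (hη1 : η ≤ 1 / 2) (hM : 0 ≤ M) (N : Finset E)
    (hN : ∀ u : E, ‖u‖ = 1 → ∃ y ∈ N, ‖u - y‖ ≤ η) (A : E →L[ℝ] F)
    (hA : ∀ y ∈ N, ‖A y‖ ≤ M) (hA' : ∀ y ∈ N, m ≤ ‖A y‖) (u : E) :
    (m - 2 * M * η) * ‖u‖ ≤ ‖A u‖ := by
  have hop := opNorm_le_of_net hη1 hM N hN A hA
  have key : ∀ v : E, ‖v‖ = 1 → m - 2 * M * η ≤ ‖A v‖ := fun v hv => by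
    obtain ⟨y, hy, hd⟩ := hN v hv
    have h1 : ‖A y‖ ≤ ‖A v‖ + ‖A (v - y)‖ := by
      calc ‖A y‖ = ‖A v - A (v - y)‖ := by rw [← map_sub]; simp
        _ ≤ _ := norm_sub_le _ _
    have h2 : ‖A (v - y)‖ ≤ 2 * M * η :=
      (A.le_opNorm _).trans (mul_le_mul hop hd (norm_nonneg _) (by positivity))
    linarith [hA' y hy]
  rcases eq_or_ne u 0 with rfl | hu
  · simp
  · have hu' : 0 < ‖u‖ := norm_pos_iff.mpr hu
    have := key (‖u‖⁻¹ • u) (by rw [norm_smul, norm_inv, norm_norm, inv_mul_cancel₀ hu'.ne'])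
    rw [map_smul, norm_smul, norm_inv, norm_norm, inv_mul_eq_div, le_div_iff₀ hu'] at this
    exact this

end Net

lemma norm_toLp_sq {ι : Type*} [Fintype ι] (u : ι → ℝ) : ‖WithLp.toLp 2 u‖ ^ 2 = u ⬝ᵥ u := by
  rw [EuclideanSpace.real_norm_sq_eq]
  simp [dotProduct, sq]

/-- A finite subset of the unit sphere of `V` that controls every quadratic form `‖A u‖²` on `V`. -/
theorem exists_quadratic_net {d : ℕ} (V : Submodule ℝ (Fin d → ℝ)) {η : ℝ} (hη : 0 < η)
    (hη1 : η ≤ 1 / 2) :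
    ∃ N : Finset (Fin d → ℝ), (N.card : ℝ) ≤ (3 / η) ^ Module.finrank ℝ V ∧
      (∀ y ∈ N, y ∈ V ∧ y ⬝ᵥ y = 1) ∧
      ∀ (ι : Type) [Fintype ι] (A : (Fin d → ℝ) →ₗ[ℝ] (ι → ℝ)) (M : ℝ), 0 ≤ M →
        (∀ y ∈ N, A y ⬝ᵥ A y ≤ M ^ 2) →
        (∀ u ∈ V, A u ⬝ᵥ A u ≤ (2 * M) ^ 2 * (u ⬝ᵥ u)) ∧
        ∀ m : ℝ, 2 * M * η ≤ m → (∀ y ∈ N, m ^ 2 ≤ A y ⬝ᵥ A y) →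
          ∀ u ∈ V, (m - 2 * M * η) ^ 2 * (u ⬝ᵥ u) ≤ A u ⬝ᵥ A u := by
  classical
  -- The norm of `Fin d → ℝ` is the sup norm, so the net is built in `EuclideanSpace`, where `‖u‖²`
  -- is `u ⬝ᵥ u`. It is chosen before `A`, as a union bound over random `A` requires.
  let e := (WithLp.linearEquiv 2 ℝ (Fin d → ℝ)).symm
  let V' : Submodule ℝ (EuclideanSpace ℝ (Fin d)) := V.map e.toLinearMap
  have hrank : Module.finrank ℝ V' = Module.finrank ℝ V := LinearEquiv.finrank_map_eq e V
  obtain ⟨N, hcard, hN1, hN⟩ := exists_finset_net_sphere (E := V') hη (by linarith)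
  have hmem : ∀ y : V', WithLp.ofLp (y : EuclideanSpace ℝ (Fin d)) ∈ V := by
    rintro ⟨_, u, hu, rfl⟩
    exact hu
  have hnorm : ∀ y : V', ‖y‖ ^ 2 =
      WithLp.ofLp (y : EuclideanSpace ℝ (Fin d)) ⬝ᵥ WithLp.ofLp (y : EuclideanSpace ℝ (Fin d)) :=
    fun y => norm_toLp_sq _
  refine ⟨N.image fun y : V' => WithLp.ofLp (y : EuclideanSpace ℝ (Fin d)), ?_, ?_, ?_⟩
  · rw [← hrank]
    exact (Nat.cast_le.mpr Finset.card_image_le).trans hcard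
  · intro y hy
    obtain ⟨z, hz, rfl⟩ := Finset.mem_image.mp hy
    refine ⟨hmem z, ?_⟩
    rw [← hnorm z, hN1 z hz, one_pow]
  · intro ι _ A M hM hA
    let A' : V' →L[ℝ] EuclideanSpace ℝ ι := LinearMap.toContinuousLinearMap
      ((WithLp.linearEquiv 2 ℝ (ι → ℝ)).symm.toLinearMap ∘ₗ A ∘ₗ e.symm.toLinearMap ∘ₗ V'.subtype)
    have hA' : ∀ y : V', ‖A' y‖ ^ 2 = A (WithLp.ofLp (y : EuclideanSpace ℝ (Fin d))) ⬝ᵥ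
        A (WithLp.ofLp (y : EuclideanSpace ℝ (Fin d))) := fun y => norm_toLp_sq _
    have hup : ∀ y ∈ N, ‖A' y‖ ≤ M := fun y hy => by
      refine (sq_le_sq₀ (norm_nonneg _) hM).mp ?_
      rw [hA']
      exact hA _ (Finset.mem_image_of_mem _ hy)
    have hop := opNorm_le_of_net hη1 hM N hN A' hup
    refine ⟨fun u hu => ?_, fun m hm hlow u hu => ?_⟩
    · let u' : V' := ⟨e u, Submodule.mem_map_of_mem hu⟩
      have h1 : ‖A' u'‖ ≤ 2 * M * ‖u'‖ := (A'.le_opNorm u').trans (by gcongr)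
      have h2 := pow_le_pow_left₀ (norm_nonneg _) h1 2
      rw [mul_pow, hA', hnorm] at h2
      exact h2
    · let u' : V' := ⟨e u, Submodule.mem_map_of_mem hu⟩
      have hm0 : 0 ≤ m := le_trans (by positivity) hm
      have h1 := le_norm_of_net (m := m) hη1 hM N hN A' hup (fun y hy => by
        refine (sq_le_sq₀ hm0 (norm_nonneg _)).mp ?_
        rw [hA']
        exact hlow _ (Finset.mem_image_of_mem _ hy)) u'
      have h2 := pow_le_pow_left₀ (mul_nonneg (by linarith) (norm_nonneg _)) h1 2
      rw [mul_pow, hA', hnorm] at h2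
      exact h2

/-! ### Exponential moments -/

lemma lintegral_exp_mul_gaussianReal (v : NNReal) (t : ℝ) :
    ∫⁻ x, ENNReal.ofReal (Real.exp (t * x)) ∂(gaussianReal 0 v) =
      ENNReal.ofReal (Real.exp (v * t ^ 2 / 2)) := by
  rw [← ofReal_integral_eq_lintegral_ofReal (integrable_exp_mul_gaussianReal t)
    (ae_of_all _ fun _ => (Real.exp_pos _).le)]
  have := mgf_gaussianReal (p := gaussianReal 0 v) (X := id) (μ := 0) (v := v) (by simp) t
  simp only [mgf, id, zero_mul, zero_add] at this
  rw [this]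

/-- The exact value is `√2`. -/
lemma lintegral_exp_sq_gaussianReal :
    ∫⁻ x, ENNReal.ofReal (Real.exp (x ^ 2 / 4)) ∂(gaussianReal 0 1) ≤ 2 := by
  rw [gaussianReal_of_var_ne_zero 0 one_ne_zero,
    lintegral_withDensity_eq_lintegral_mul _ (measurable_gaussianPDF 0 1) (by fun_prop)]
  have h1 : ∀ x : ℝ, (gaussianPDF 0 1 * fun x => ENNReal.ofReal (Real.exp (x ^ 2 / 4))) x =
      ENNReal.ofReal ((√(2 * Real.pi))⁻¹ * Real.exp (-(1 / 4) * x ^ 2)) := fun x => by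
    rw [Pi.mul_apply, gaussianPDF, ← ENNReal.ofReal_mul (gaussianPDFReal_nonneg _ _ _),
      gaussianPDFReal]
    simp only [NNReal.coe_one, mul_one, sub_zero]
    rw [mul_assoc, ← Real.exp_add]
    congr 3
    ring
  simp_rw [h1]
  rw [← ofReal_integral_eq_lintegral_ofReal
    ((integrable_exp_neg_mul_sq (by norm_num)).const_mul _)
    (ae_of_all _ fun _ => by positivity), integral_const_mul, integral_gaussian]
  rw [show (2 : ENNReal) = ENNReal.ofReal 2 by simp]
  refine ENNReal.ofReal_le_ofReal ?_
  have hpi := Real.pi_pos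
  rw [inv_mul_le_iff₀ (by positivity)]
  rw [Real.sqrt_le_left (by positivity), mul_pow, Real.sq_sqrt (by positivity)]
  linarith

/-- Exponential moments of the square of a sub-gaussian variable. -/
lemma lintegral_exp_sq_le_of_hasSubgaussianMGF {Ω : Type*} [MeasurableSpace Ω] {μ : Measure Ω}
    [IsProbabilityMeasure μ] {X : Ω → ℝ} {c : NNReal} (hX : HasSubgaussianMGF X c μ)
    (hXm : Measurable X) {s : ℝ} (hs : 0 ≤ s) (hsc : s * c ≤ 1 / 4) :
    ∫⁻ ω, ENNReal.ofReal (Real.exp (s * X ω ^ 2)) ∂μ ≤ 2 := by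
  -- Gaussian linearization: the square in the exponent becomes an average of linear exponents.
  -- After the integrals are swapped, the sub-gaussian bound leaves `exp (s c g²) ≤ exp (g² / 4)`.
  have h1 : ∀ ω, ENNReal.ofReal (Real.exp (s * X ω ^ 2)) =
      ∫⁻ g, ENNReal.ofReal (Real.exp ((√(2 * s) * X ω) * g)) ∂(gaussianReal 0 1) := fun ω => by
    rw [lintegral_exp_mul_gaussianReal, mul_pow, Real.sq_sqrt (by positivity)]
    congr 2
    simp
    ring
  simp_rw [h1]
  rw [lintegral_lintegral_swap (by fun_prop)]
  refine le_trans (lintegral_mono fun g => ?_) lintegral_exp_sq_gaussianReal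
  have h2 : ∀ ω, Real.exp ((√(2 * s) * X ω) * g) = Real.exp ((√(2 * s) * g) * X ω) := fun ω => by
    congr 1
    ring
  simp_rw [h2]
  rw [← ofReal_integral_eq_lintegral_ofReal (hX.integrable_exp_mul _)
    (ae_of_all _ fun _ => (Real.exp_pos _).le)]
  refine ENNReal.ofReal_le_ofReal ((hX.mgf_le _).trans (Real.exp_le_exp.mpr ?_))
  rw [mul_pow, Real.sq_sqrt (by positivity)]
  nlinarith [sq_nonneg g]

lemma exp_le_one_add_add_sq_mul_exp_abs (x : ℝ) :
    Real.exp x ≤ 1 + x + x ^ 2 * Real.exp |x| := by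
  have h := Complex.norm_exp_sub_sum_le_norm_mul_exp (x : ℂ) 2
  simp only [Finset.sum_range_succ, Finset.range_zero, Finset.sum_empty, pow_zero,
    Nat.factorial_zero, Nat.cast_one, div_one, zero_add, pow_one, Nat.factorial_one,
    Complex.norm_real, Real.norm_eq_abs, sq_abs] at h
  rw [← Complex.ofReal_exp, ← Complex.ofReal_one, ← Complex.ofReal_add, ← Complex.ofReal_sub,
    Complex.norm_real, Real.norm_eq_abs] at h
  linarith [le_abs_self (Real.exp x - (1 + x))]

/-- Bernstein-type moment bound for a nonnegative variable with an exponential moment. -/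
lemma lintegral_exp_mul_sub_le {Ω : Type*} [MeasurableSpace Ω] {μ : Measure Ω}
    [IsProbabilityMeasure μ] {Y : Ω → ℝ} (hY : Measurable Y) (hY0 : ∀ ω, 0 ≤ Y ω) {r l τ : ℝ}
    (hr : 0 < r) (hE : ∫⁻ ω, ENNReal.ofReal (Real.exp (Y ω / (4 * r))) ∂μ ≤ 2)
    (hl : |l| ≤ 1 / (8 * r)) (hτ : l * ∫ ω, Y ω ∂μ ≤ τ) :
    ∫⁻ ω, ENNReal.ofReal (Real.exp (l * Y ω - τ)) ∂μ ≤
      ENNReal.ofReal (Real.exp (256 * l ^ 2 * r ^ 2)) := by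
  have hEi : Integrable (fun ω => Real.exp (Y ω / (4 * r))) μ := by
    refine ⟨by fun_prop, ?_⟩
    rw [hasFiniteIntegral_iff_ofReal (ae_of_all _ fun _ => (Real.exp_pos _).le)]
    exact hE.trans_lt (by simp)
  have hEr : ∫ ω, Real.exp (Y ω / (4 * r)) ∂μ ≤ 2 := by
    rw [integral_eq_lintegral_of_nonneg_ae (ae_of_all _ fun _ => (Real.exp_pos _).le)
      (by fun_prop)]
    exact ENNReal.toReal_le_of_le_ofReal (by norm_num) (by simpa using hE)
  have hYi : Integrable Y μ := by
    refine (hEi.const_mul (4 * r)).mono' (by fun_prop) (ae_of_all _ fun ω => ?_)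
    rw [Real.norm_eq_abs, abs_of_nonneg (hY0 ω)]
    have := Real.add_one_le_exp (Y ω / (4 * r))
    rw [← div_le_iff₀' (by positivity)]
    linarith
  -- Half of the available exponent `Y / (4 r)` pays for `exp |l Y|`, the other half for `Y²`
  -- through `t² / 2 ≤ exp t`. The mean of the full exponential is at most `2`, whence `256 = 2 ·
  -- 128`.
  have hpt : ∀ ω, Real.exp (l * Y ω) ≤
      1 + l * Y ω + 128 * l ^ 2 * r ^ 2 * Real.exp (Y ω / (4 * r)) := fun ω => by
    refine (exp_le_one_add_add_sq_mul_exp_abs _).trans ?_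
    have h1 : Real.exp |l * Y ω| ≤ Real.exp (Y ω / (8 * r)) := by
      rw [Real.exp_le_exp, abs_mul, abs_of_nonneg (hY0 ω)]
      calc |l| * Y ω ≤ 1 / (8 * r) * Y ω := mul_le_mul_of_nonneg_right hl (hY0 ω)
        _ = Y ω / (8 * r) := by ring
    have h2 : Y ω ^ 2 ≤ 128 * r ^ 2 * Real.exp (Y ω / (8 * r)) := by
      have h3 := Real.quadratic_le_exp_of_nonneg (x := Y ω / (8 * r))
        (div_nonneg (hY0 ω) (by positivity))
      have h4 : (Y ω / (8 * r)) ^ 2 / 2 ≤ Real.exp (Y ω / (8 * r)) := by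
        have : 0 ≤ Y ω / (8 * r) := div_nonneg (hY0 ω) (by positivity)
        linarith
      have h5 : (Y ω / (8 * r)) ^ 2 / 2 = Y ω ^ 2 / (128 * r ^ 2) := by
        field_simp
        ring
      rw [h5, div_le_iff₀ (by positivity)] at h4
      linarith
    have h6 : Real.exp (Y ω / (4 * r)) = Real.exp (Y ω / (8 * r)) * Real.exp (Y ω / (8 * r)) := by
      rw [← Real.exp_add]
      congr 1
      field_simp
      ring
    have h7 : (l * Y ω) ^ 2 * Real.exp |l * Y ω| ≤
        128 * l ^ 2 * r ^ 2 * Real.exp (Y ω / (4 * r)) := by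
      rw [h6]
      calc (l * Y ω) ^ 2 * Real.exp |l * Y ω|
          = l ^ 2 * (Y ω ^ 2 * Real.exp |l * Y ω|) := by ring
        _ ≤ l ^ 2 * ((128 * r ^ 2 * Real.exp (Y ω / (8 * r))) * Real.exp (Y ω / (8 * r))) := by
            gcongr
        _ = _ := by ring
    linarith
  have hIi : Integrable (fun ω =>
      1 + l * Y ω + 128 * l ^ 2 * r ^ 2 * Real.exp (Y ω / (4 * r))) μ :=
    ((integrable_const _).add (hYi.const_mul l)).add (hEi.const_mul _)
  have hbound : ∫ ω, (1 + l * Y ω + 128 * l ^ 2 * r ^ 2 * Real.exp (Y ω / (4 * r))) ∂μ ≤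
      1 + τ + 256 * l ^ 2 * r ^ 2 := by
    have hA : Integrable (fun ω => 1 + l * Y ω) μ := (integrable_const _).add (hYi.const_mul l)
    rw [integral_add hA (hEi.const_mul _), integral_add (integrable_const _) (hYi.const_mul l), integral_const_mul, integral_const_mul]
    simp only [integral_const, probReal_univ, smul_eq_mul, mul_one]
    have : 0 ≤ 128 * l ^ 2 * r ^ 2 := by positivity
    nlinarith
  calc ∫⁻ ω, ENNReal.ofReal (Real.exp (l * Y ω - τ)) ∂μ
      ≤ ∫⁻ ω, ENNReal.ofReal (Real.exp (-τ) *
          (1 + l * Y ω + 128 * l ^ 2 * r ^ 2 * Real.exp (Y ω / (4 * r)))) ∂μ := by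
        refine lintegral_mono fun ω => ENNReal.ofReal_le_ofReal ?_
        rw [sub_eq_neg_add, Real.exp_add]
        exact mul_le_mul_of_nonneg_left (hpt ω) (Real.exp_pos _).le
    _ = ENNReal.ofReal (Real.exp (-τ) *
          ∫ ω, (1 + l * Y ω + 128 * l ^ 2 * r ^ 2 * Real.exp (Y ω / (4 * r))) ∂μ) := by
        rw [← integral_const_mul, ofReal_integral_eq_lintegral_ofReal (hIi.const_mul _)]
        exact ae_of_all _ fun ω => mul_nonneg (Real.exp_pos _).le
          ((Real.exp_pos _).le.trans (hpt ω))
    _ ≤ ENNReal.ofReal (Real.exp (-τ) * Real.exp (τ + 256 * l ^ 2 * r ^ 2)) := by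
        refine ENNReal.ofReal_le_ofReal (mul_le_mul_of_nonneg_left ?_ (Real.exp_pos _).le)
        have := Real.add_one_le_exp (τ + 256 * l ^ 2 * r ^ 2)
        linarith
    _ = _ := by
        rw [← Real.exp_add]
        congr 2
        ring

/-! ### Product measures -/

lemma lintegral_pi_prod {ι : Type*} [Fintype ι] {Ω : ι → Type*} [∀ i, MeasurableSpace (Ω i)]
    (μ : ∀ i, Measure (Ω i)) [∀ i, IsProbabilityMeasure (μ i)] {f : ∀ i, Ω i → ENNReal}
    (hf : ∀ i, Measurable (f i)) :
    ∫⁻ ω, ∏ i, f i (ω i) ∂(Measure.pi μ) = ∏ i, ∫⁻ x, f i x ∂(μ i) := by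
  have h := lintegral_prod_eq_prod_lintegral_of_indepFun (μ := Measure.pi μ) Finset.univ
    (fun i (ω : ∀ i, Ω i) => f i (ω i)) (iIndepFun_pi fun i => (hf i).aemeasurable)
    fun i => (hf i).comp (measurable_pi_apply i)
  rw [h]
  refine Finset.prod_congr rfl fun i _ => ?_
  exact (measurePreserving_eval μ i).lintegral_comp (hf i)

/-- Chernoff's inequality. -/
lemma measure_le_exp_of_lintegral_exp_le {Ω : Type*} [MeasurableSpace Ω] {μ : Measure Ω}
    {f : Ω → ENNReal} (hf : Measurable f) {κ s : ℝ} (h : ∫⁻ ω, f ω ∂μ ≤ ENNReal.ofReal (Real.exp κ)) :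
    μ {ω | ENNReal.ofReal (Real.exp s) ≤ f ω} ≤ ENNReal.ofReal (Real.exp (κ - s)) := by
  have h1 := (mul_meas_ge_le_lintegral₀ hf.aemeasurable (ENNReal.ofReal (Real.exp s))).trans h
  rw [Real.exp_sub, ENNReal.ofReal_div_of_pos (Real.exp_pos s), ENNReal.le_div_iff_mul_le
    (Or.inl (by simpa using Real.exp_pos s)) (Or.inl (by simp)), mul_comm]
  exact h1

lemma measure_pi_sum_ge_le {α : Type*} [MeasurableSpace α] {μ : Measure α}
    [IsProbabilityMeasure μ] {f : α → ℝ} (hf : Measurable f) {κ : ℝ}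
    (h : ∫⁻ x, ENNReal.ofReal (Real.exp (f x)) ∂μ ≤ ENNReal.ofReal (Real.exp κ)) (n : ℕ) (s : ℝ) :
    (Measure.pi fun _ : Fin n => μ) {D | s ≤ ∑ j, f (D j)} ≤
      ENNReal.ofReal (Real.exp (n * κ - s)) := by
  have hprod : ∀ D : Fin n → α, ENNReal.ofReal (Real.exp (∑ j, f (D j))) =
      ∏ j, ENNReal.ofReal (Real.exp (f (D j))) := fun D => by
    rw [Real.exp_sum, ENNReal.ofReal_prod_of_nonneg fun _ _ => (Real.exp_pos _).le]
  have h1 : ∫⁻ D, ENNReal.ofReal (Real.exp (∑ j, f (D j))) ∂(Measure.pi fun _ : Fin n => μ) ≤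
      ENNReal.ofReal (Real.exp (n * κ)) := by
    simp_rw [hprod]
    rw [lintegral_pi_prod (fun _ : Fin n => μ) (f := fun _ x => ENNReal.ofReal (Real.exp (f x)))
      (fun _ => by fun_prop)]
    rw [Finset.prod_const, Finset.card_univ, Fintype.card_fin, Real.exp_nat_mul,
      ENNReal.ofReal_pow (Real.exp_pos _).le]
    exact pow_le_pow_left' h n
  refine le_trans (measure_mono fun D hD => ?_)
    (measure_le_exp_of_lintegral_exp_le (f := fun D : Fin n → α =>
      ENNReal.ofReal (Real.exp (∑ j, f (D j)))) (by fun_prop) h1)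
  exact ENNReal.ofReal_le_ofReal (Real.exp_le_exp.mpr hD)

/-! ### Input laws -/

namespace IsGoodInput

variable {d : ℕ} {a b : ℝ} {ρ : NNReal} {p : Measure (Fin d → ℝ)}

lemma memLp_coord (h : IsGoodInput a b ρ p) (i : Fin d) : MemLp (fun x : Fin d → ℝ => x i) 2 p := by
  have h1 := (h.subgaussian (Pi.single i 1) (by simp)).memLp 2
  simpa using h1

lemma integrable_coord_mul (h : IsGoodInput a b ρ p) (i j : Fin d) :
    Integrable (fun x : Fin d → ℝ => x i * x j) p :=
  (h.memLp_coord i).integrable_mul (h.memLp_coord j)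

lemma dotProduct_sq_eq (u x : Fin d → ℝ) :
    (u ⬝ᵥ x) ^ 2 = ∑ i, ∑ j, u i * u j * (x i * x j) := by
  rw [sq, dotProduct, Finset.sum_mul_sum]
  exact Finset.sum_congr rfl fun i _ => Finset.sum_congr rfl fun j _ => by ring

lemma integrable_dotProduct_sq (h : IsGoodInput a b ρ p) (u : Fin d → ℝ) :
    Integrable (fun x => (u ⬝ᵥ x) ^ 2) p := by
  simp_rw [dotProduct_sq_eq]
  exact integrable_finsetSum _ fun i _ => integrable_finsetSum _ fun j _ =>
    (h.integrable_coord_mul i j).const_mul _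

lemma integral_dotProduct_sq (h : IsGoodInput a b ρ p) (u : Fin d → ℝ) :
    ∫ x, (u ⬝ᵥ x) ^ 2 ∂p = u ⬝ᵥ (secondMoment p *ᵥ u) := by
  simp_rw [dotProduct_sq_eq]
  rw [integral_finsetSum _ fun i _ => integrable_finsetSum _ fun j _ =>
    (h.integrable_coord_mul i j).const_mul _]
  simp only [dotProduct, mulVec, secondMoment, of_apply, Finset.mul_sum]
  refine Finset.sum_congr rfl fun i _ => ?_
  rw [integral_finsetSum _ fun j _ => (h.integrable_coord_mul i j).const_mul _]
  refine Finset.sum_congr rfl fun j _ => ?_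
  rw [integral_const_mul]
  ring

lemma le_integral_sq (h : IsGoodInput a b ρ p) (u : Fin d → ℝ) :
    a * (u ⬝ᵥ u) ≤ ∫ x, (u ⬝ᵥ x) ^ 2 ∂p := by
  rw [h.integral_dotProduct_sq]
  have := h.lower.dotProduct_mulVec_nonneg u
  simp only [star_trivial, sub_mulVec, dotProduct_sub, smul_mulVec, one_mulVec,
    dotProduct_smul, smul_eq_mul] at this
  linarith

lemma integral_sq_le (h : IsGoodInput a b ρ p) (u : Fin d → ℝ) :
    ∫ x, (u ⬝ᵥ x) ^ 2 ∂p ≤ b * (u ⬝ᵥ u) := by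
  rw [h.integral_dotProduct_sq]
  have := h.upper.dotProduct_mulVec_nonneg u
  simp only [star_trivial, sub_mulVec, dotProduct_sub, smul_mulVec, one_mulVec,
    dotProduct_smul, smul_eq_mul] at this
  linarith

end IsGoodInput

lemma measurable_dotProduct_left {d : ℕ} (u : Fin d → ℝ) : Measurable fun x => u ⬝ᵥ x := by
  unfold dotProduct
  fun_prop

/-! ### The law of a labelled sample -/

lemma predict_eq {d k : ℕ} (B : Matrix (Fin d) (Fin k) ℝ) (w : Fin k → ℝ) (x : Fin d → ℝ) :
    predict B w x = (B *ᵥ w) ⬝ᵥ x := by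
  rw [predict, mulVec_transpose, ← dotProduct_mulVec, dotProduct_comm]

/-- Law of `(x, vᵀ x + z)` with `x ∼ p` and independent Gaussian noise `z`. -/
noncomputable def linearLaw {d : ℕ} (p : Measure (Fin d → ℝ)) (v : Fin d → ℝ) (σ : NNReal) :
    Measure ((Fin d → ℝ) × ℝ) :=
  (p.prod (gaussianReal 0 (σ ^ 2))).map (fun q => (q.1, v ⬝ᵥ q.1 + q.2))

lemma taskLaw_eq {d k : ℕ} (p : Measure (Fin d → ℝ)) (B : Matrix (Fin d) (Fin k) ℝ)
    (w : Fin k → ℝ) (σ : NNReal) : taskLaw p B w σ = linearLaw p (B *ᵥ w) σ := by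
  simp only [taskLaw, linearLaw, predict_eq]

section LinearLaw

variable {d : ℕ} (p : Measure (Fin d → ℝ)) (v : Fin d → ℝ) (σ : NNReal)

lemma measurable_linearLabel :
    Measurable (fun q : (Fin d → ℝ) × ℝ => (q.1, v ⬝ᵥ q.1 + q.2)) := by
  have := measurable_dotProduct_left v
  fun_prop

instance [IsProbabilityMeasure p] : IsProbabilityMeasure (linearLaw p v σ) :=
  Measure.isProbabilityMeasure_map (measurable_linearLabel v).aemeasurable

lemma lintegral_linearLaw [IsProbabilityMeasure p] {f : (Fin d → ℝ) × ℝ → ENNReal}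
    (hf : Measurable f) :
    ∫⁻ q, f q ∂(linearLaw p v σ) =
      ∫⁻ x, ∫⁻ z, f (x, v ⬝ᵥ x + z) ∂(gaussianReal 0 (σ ^ 2)) ∂p := by
  rw [linearLaw, lintegral_map hf (measurable_linearLabel v),
    lintegral_prod (fun q : (Fin d → ℝ) × ℝ => f (q.1, v ⬝ᵥ q.1 + q.2))
      (hf.comp (measurable_linearLabel v)).aemeasurable]

lemma lintegral_linearLaw_fst [IsProbabilityMeasure p] {f : (Fin d → ℝ) → ENNReal}
    (hf : Measurable f) : ∫⁻ q, f q.1 ∂(linearLaw p v σ) = ∫⁻ x, f x ∂p := by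
  rw [lintegral_linearLaw p v σ (f := fun q => f q.1) (hf.comp measurable_fst)]
  simp

end LinearLaw

/-! ### Empirical design and noise -/

/-- The design of a data set as a linear map `u ↦ (uᵀ x_j)_j`. -/
def designMap {d n : ℕ} (D : Fin n → (Fin d → ℝ) × ℝ) : (Fin d → ℝ) →ₗ[ℝ] (Fin n → ℝ) where
  toFun u j := u ⬝ᵥ (D j).1
  map_add' u w := by
    ext j
    simp [add_dotProduct]
  map_smul' c u := by
    ext j
    simp

/-- The empirical correlation `u ↦ ∑_j (y_j - vᵀ x_j) uᵀ x_j` of noise and inputs. -/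
def noiseForm {d n : ℕ} (v : Fin d → ℝ) (D : Fin n → (Fin d → ℝ) × ℝ) :
    (Fin d → ℝ) →ₗ[ℝ] ℝ where
  toFun u := ∑ j, ((D j).2 - v ⬝ᵥ (D j).1) * (u ⬝ᵥ (D j).1)
  map_add' u w := by simp [add_dotProduct, mul_add, Finset.sum_add_distrib]
  map_smul' c u := by
    simp only [smul_dotProduct, smul_eq_mul, RingHom.id_apply, Finset.mul_sum]
    exact Finset.sum_congr rfl fun _ _ => by ring

lemma designMap_dotProduct_self {d n : ℕ} (D : Fin n → (Fin d → ℝ) × ℝ) (u : Fin d → ℝ) :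
    designMap D u ⬝ᵥ designMap D u = ∑ j, (u ⬝ᵥ (D j).1) ^ 2 := by
  simp [designMap, dotProduct, sq]

/-- The empirical second moments are comparable with the squared norm on `V`. -/
def GoodDesign {d n : ℕ} (a b : ℝ) (V : Submodule ℝ (Fin d → ℝ))
    (D : Fin n → (Fin d → ℝ) × ℝ) : Prop :=
  ∀ u ∈ V, n * (a / 8) * (u ⬝ᵥ u) ≤ designMap D u ⬝ᵥ designMap D u ∧
    designMap D u ⬝ᵥ designMap D u ≤ 8 * b * n * (u ⬝ᵥ u)

lemma measurable_designMap_sq {d n : ℕ} (u : Fin d → ℝ) :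
    Measurable fun D : Fin n → (Fin d → ℝ) × ℝ => designMap D u ⬝ᵥ designMap D u := by
  simp_rw [designMap_dotProduct_self]
  have := measurable_dotProduct_left u
  fun_prop

lemma measurable_noiseForm {d n : ℕ} (v u : Fin d → ℝ) :
    Measurable fun D : Fin n → (Fin d → ℝ) × ℝ => noiseForm v D u := by
  have := measurable_dotProduct_left u
  have := measurable_dotProduct_left v
  simp only [noiseForm, LinearMap.coe_mk, AddHom.coe_mk]
  fun_prop

section Tail

variable {d : ℕ} {a b : ℝ} {ρ : NNReal} {p : Measure (Fin d → ℝ)}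

lemma IsGoodInput.lintegral_exp_sq (h : IsGoodInput a b ρ p) (hρ : 1 ≤ ρ) {u : Fin d → ℝ}
    (hu : u ⬝ᵥ u = 1) {l τ : ℝ} (hl : |l| ≤ 1 / (8 * (ρ : ℝ) ^ 2))
    (hτ : l * ∫ x, (u ⬝ᵥ x) ^ 2 ∂p ≤ τ) (v : Fin d → ℝ) (σ : NNReal) :
    ∫⁻ q, ENNReal.ofReal (Real.exp (l * (u ⬝ᵥ q.1) ^ 2 - τ)) ∂(linearLaw p v σ) ≤
      ENNReal.ofReal (Real.exp (256 * l ^ 2 * (ρ : ℝ) ^ 4)) := by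
  have := h.prob
  have hm := measurable_dotProduct_left u
  have hρ' : (0 : ℝ) < ρ := lt_of_lt_of_le one_pos (by exact_mod_cast hρ)
  rw [lintegral_linearLaw_fst p v σ
    (f := fun x => ENNReal.ofReal (Real.exp (l * (u ⬝ᵥ x) ^ 2 - τ))) (by fun_prop)]
  have := lintegral_exp_mul_sub_le (μ := p) (Y := fun x => (u ⬝ᵥ x) ^ 2) (r := (ρ : ℝ) ^ 2)
    (l := l) (τ := τ) (by fun_prop) (fun _ => sq_nonneg _) (by positivity) ?_ hl hτ
  · refine this.trans (le_of_eq ?_)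
    congr 2
    ring
  · have := lintegral_exp_sq_le_of_hasSubgaussianMGF (h.subgaussian u hu) hm
      (s := 1 / (4 * (ρ : ℝ) ^ 2)) (by positivity) (by
        push_cast
        rw [div_mul_eq_mul_div, one_mul, div_le_iff₀ (by positivity)]
        linarith)
    refine le_trans (le_of_eq ?_) this
    congr with x
    congr 2
    field_simp

lemma IsGoodInput.measure_design_upper (h : IsGoodInput a b ρ p) (hρ : 1 ≤ ρ) {u : Fin d → ℝ}
    (hu : u ⬝ᵥ u = 1) {τ : ℝ} (hτ : 0 < τ) (hτ1 : τ ≤ 1) (v : Fin d → ℝ) (σ : NNReal) (n : ℕ) :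
    (Measure.pi fun _ : Fin n => linearLaw p v σ)
        {D | n * (b + τ) ≤ designMap D u ⬝ᵥ designMap D u} ≤
      ENNReal.ofReal (Real.exp (-(n * τ ^ 2 / (1024 * (ρ : ℝ) ^ 4)))) := by
  have := h.prob
  have hm := measurable_dotProduct_left u
  have hρ1 : (1 : ℝ) ≤ ρ := by exact_mod_cast hρ
  have hρ' : (0 : ℝ) < ρ := lt_of_lt_of_le one_pos hρ1
  -- This `l` minimizes `256 l² ρ⁴ - l τ`, with minimum `-τ² / (1024 ρ⁴)`; `τ ≤ 1 ≤ ρ` keeps it in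
  -- the admissible range.
  set l := τ / (512 * (ρ : ℝ) ^ 4) with hl
  have hl0 : 0 < l := by positivity
  have hl8 : |l| ≤ 1 / (8 * (ρ : ℝ) ^ 2) := by
    rw [abs_of_pos hl0, hl, div_le_div_iff₀ (by positivity) (by positivity)]
    have : (ρ : ℝ) ^ 2 ≤ (ρ : ℝ) ^ 4 := pow_le_pow_right₀ hρ1 (by norm_num)
    nlinarith [sq_nonneg (ρ : ℝ)]
  have hE : l * ∫ x, (u ⬝ᵥ x) ^ 2 ∂p ≤ l * b := by
    have := h.integral_sq_le u
    rw [hu, mul_one] at this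
    gcongr
  have key := measure_pi_sum_ge_le (μ := linearLaw p v σ) (by fun_prop)
    (h.lintegral_exp_sq hρ hu hl8 hE v σ) n (n * (l * τ))
  refine (measure_mono fun D hD => ?_).trans (key.trans (le_of_eq ?_))
  · have hD' : n * (b + τ) ≤ designMap D u ⬝ᵥ designMap D u := hD
    rw [designMap_dotProduct_self] at hD'
    change n * (l * τ) ≤ ∑ j, (l * (u ⬝ᵥ (D j).1) ^ 2 - l * b)
    rw [Finset.sum_sub_distrib, ← Finset.mul_sum]
    simp only [Finset.sum_const, Finset.card_univ, Fintype.card_fin, nsmul_eq_mul]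
    nlinarith
  · congr 2
    rw [hl]
    field_simp
    ring

lemma IsGoodInput.measure_design_lower (h : IsGoodInput a b ρ p) (hρ : 1 ≤ ρ) {u : Fin d → ℝ}
    (hu : u ⬝ᵥ u = 1) {τ : ℝ} (hτ : 0 < τ) (hτ1 : τ ≤ 1) (v : Fin d → ℝ) (σ : NNReal) (n : ℕ) :
    (Measure.pi fun _ : Fin n => linearLaw p v σ)
        {D | designMap D u ⬝ᵥ designMap D u ≤ n * (a - τ)} ≤
      ENNReal.ofReal (Real.exp (-(n * τ ^ 2 / (1024 * (ρ : ℝ) ^ 4)))) := by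
  have := h.prob
  have hm := measurable_dotProduct_left u
  have hρ1 : (1 : ℝ) ≤ ρ := by exact_mod_cast hρ
  have hρ' : (0 : ℝ) < ρ := lt_of_lt_of_le one_pos hρ1
  -- The same optimal parameter, used with a negative sign for the lower tail.
  set l := τ / (512 * (ρ : ℝ) ^ 4) with hl
  have hl0 : 0 < l := by positivity
  have hl8 : |-l| ≤ 1 / (8 * (ρ : ℝ) ^ 2) := by
    rw [abs_neg, abs_of_pos hl0, hl, div_le_div_iff₀ (by positivity) (by positivity)]
    have : (ρ : ℝ) ^ 2 ≤ (ρ : ℝ) ^ 4 := pow_le_pow_right₀ hρ1 (by norm_num)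
    nlinarith [sq_nonneg (ρ : ℝ)]
  have hE : -l * ∫ x, (u ⬝ᵥ x) ^ 2 ∂p ≤ -l * a := by
    have := h.le_integral_sq u
    rw [hu, mul_one] at this
    nlinarith
  have key := measure_pi_sum_ge_le (μ := linearLaw p v σ) (by fun_prop)
    (h.lintegral_exp_sq hρ hu hl8 hE v σ) n (n * (l * τ))
  refine (measure_mono fun D hD => ?_).trans (key.trans (le_of_eq ?_))
  · have hD' : designMap D u ⬝ᵥ designMap D u ≤ n * (a - τ) := hD
    rw [designMap_dotProduct_self] at hD'
    change n * (l * τ) ≤ ∑ j, (-l * (u ⬝ᵥ (D j).1) ^ 2 - -l * a)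
    rw [Finset.sum_sub_distrib, ← Finset.mul_sum]
    simp only [Finset.sum_const, Finset.card_univ, Fintype.card_fin, nsmul_eq_mul]
    nlinarith
  · congr 2
    rw [hl]
    field_simp
    ring

/-- With enough samples, the empirical second moments on a subspace of dimension `r` are comparable
with the squared norm. -/
theorem exists_goodDesign_const {a b : ℝ} (ha : 0 < a) (hab : a ≤ b) :
    ∃ C : ℝ, 0 < C ∧ ∀ (d r n : ℕ) (ρ : NNReal) (p : Measure (Fin d → ℝ)) (v : Fin d → ℝ)
      (σ : NNReal) (V : Submodule ℝ (Fin d → ℝ)) (δ : ℝ), 1 ≤ ρ → IsGoodInput a b ρ p →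
      Module.finrank ℝ V ≤ r → 1 ≤ r → 0 < δ → δ ≤ 1 →
      C * (ρ : ℝ) ^ 4 * (r + Real.log (1 / δ)) ≤ n →
      (Measure.pi fun _ : Fin n => linearLaw p v σ) {D | ¬ GoodDesign a b V D} ≤
        ENNReal.ofReal δ := by
  have hb : 0 < b := ha.trans_le hab
  -- With `M = √(2bn)` and `m = √(na/2)` as bounds on the net, this mesh makes the perturbation `2 M
  -- η` equal to `m / 2`. The resulting `(m / 2)²` and `(2 M)²` are the constants `a / 8` and `8 b`
  -- of `GoodDesign`.
  set η := √(a / b) / 8 with hη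
  have hη0 : 0 < η := by positivity
  have hη1 : η ≤ 1 / 8 := by
    have : √(a / b) ≤ 1 := Real.sqrt_le_one.mpr ((div_le_one hb).mpr hab)
    linarith
  -- Ensures `b + τ ≤ 2 b` and `a - τ ≥ a / 2`, together with `τ ≤ 1` for the tail bounds.
  set τ := min (a / 2) 1 with hτ
  have hτ0 : 0 < τ := lt_min (by positivity) one_pos
  have hτ1 : τ ≤ 1 := min_le_right _ _
  have hτa : τ ≤ a / 2 := min_le_left _ _
  have hK1 : 1 ≤ 3 / η := by
    rw [le_div_iff₀ hη0]
    linarith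
  have hκ : 0 ≤ Real.log (3 / η) := Real.log_nonneg hK1
  refine ⟨1024 / τ ^ 2 * (Real.log (3 / η) + 1), by positivity, ?_⟩
  intro d r n ρ p v σ V δ hρ hp hV hr hδ hδ1 hn
  have := hp.prob
  have hρ1 : (1 : ℝ) ≤ ρ := by exact_mod_cast hρ
  have hρ0 : (0 : ℝ) < ρ := by linarith
  obtain ⟨N, hNcard, hNs, hN⟩ := exists_quadratic_net V hη0 (by linarith : η ≤ 1 / 2)
  set P := Measure.pi fun _ : Fin n => linearLaw p v σ with hP
  have hsub : {D | ¬ GoodDesign a b V D} ⊆ ⋃ y ∈ N,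
      ({D : Fin n → (Fin d → ℝ) × ℝ | n * (b + τ) ≤ designMap D y ⬝ᵥ designMap D y} ∪
        {D | designMap D y ⬝ᵥ designMap D y ≤ n * (a - τ)}) := by
    intro D hD
    by_contra hcon
    simp only [Set.mem_iUnion, Set.mem_union, Set.mem_ofPred_eq, not_exists, not_or, not_le] at hcon
    refine hD ?_
    have hM : (√(2 * b * n)) ^ 2 = 2 * b * n := Real.sq_sqrt (by positivity)
    obtain ⟨h1, h2⟩ := hN (Fin n) (designMap D) (√(2 * b * n)) (by positivity) fun y hy => by
      rw [hM]
      have := (hcon y hy).1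
      have hn0 : (0 : ℝ) ≤ n := Nat.cast_nonneg n
      nlinarith
    have hsq : 2 * √(2 * b * n) * η = √(n * a / 2) / 2 := by
      have : √(2 * b * n) * √(a / b) = 2 * √(n * a / 2) := by
        rw [← Real.sqrt_mul (by positivity), show (2 : ℝ) = √(2 ^ 2) by simp,
          ← Real.sqrt_mul (by positivity)]
        simp only [Nat.ofNat_nonneg, Real.sqrt_sq]
        congr 1
        field_simp
      rw [hη]
      linarith
    have hm : (√(n * a / 2)) ^ 2 = n * a / 2 := Real.sq_sqrt (by positivity)
    have h3 := h2 (√(n * a / 2)) (by rw [hsq]; linarith [Real.sqrt_nonneg (n * a / 2)])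
      fun y hy => by
        rw [hm]
        have := (hcon y hy).2
        have hn0 : (0 : ℝ) ≤ n := Nat.cast_nonneg n
        nlinarith
    intro u hu
    constructor
    · have := h3 u hu
      rw [hsq, show √(n * a / 2) - √(n * a / 2) / 2 = √(n * a / 2) / 2 by ring, div_pow, hm] at this
      calc _ = n * a / 2 / 2 ^ 2 * (u ⬝ᵥ u) := by ring
        _ ≤ _ := this
    · have := h1 u hu
      rw [mul_pow, hM] at this
      calc _ ≤ _ := this
        _ = _ := by ring
  set e := Real.exp (-(n * τ ^ 2 / (1024 * (ρ : ℝ) ^ 4))) with he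
  -- Union bound: at most `(3 / η) ^ r` net points with two tail events each.
  have hexp : (3 / η) ^ r * (2 * e) ≤ δ := by
    have h1 : (Real.log (3 / η) + 1) * (r + Real.log (1 / δ)) ≤
        n * τ ^ 2 / (1024 * (ρ : ℝ) ^ 4) := by
      rw [le_div_iff₀ (by positivity)]
      calc _ = (1024 / τ ^ 2 * (Real.log (3 / η) + 1) * (ρ : ℝ) ^ 4 * (r + Real.log (1 / δ))) *
            τ ^ 2 := by field_simp
        _ ≤ _ := by gcongr
    have hlog : 0 ≤ Real.log (1 / δ) := Real.log_nonneg (by rw [le_div_iff₀ hδ]; linarith)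
    have hr1 : (1 : ℝ) ≤ r := by exact_mod_cast hr
    have h2 : r * Real.log (3 / η) + Real.log 2 + Real.log (1 / δ) ≤
        n * τ ^ 2 / (1024 * (ρ : ℝ) ^ 4) := by
      have : Real.log 2 ≤ 1 := by linarith [Real.log_two_lt_d9]
      nlinarith [mul_nonneg hκ hlog]
    calc (3 / η) ^ r * (2 * e) = Real.exp (r * Real.log (3 / η) + Real.log 2 +
          -(n * τ ^ 2 / (1024 * (ρ : ℝ) ^ 4))) := by
          rw [Real.exp_add, Real.exp_add, Real.exp_log two_pos, ← Real.log_pow,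
            Real.exp_log (by positivity)]
          ring
      _ ≤ Real.exp (-Real.log (1 / δ)) := Real.exp_le_exp.mpr (by linarith)
      _ = δ := by rw [one_div, Real.log_inv, neg_neg, Real.exp_log hδ]
  calc P {D | ¬ GoodDesign a b V D} ≤ ∑ y ∈ N, P (_ ∪ _) :=
        (measure_mono hsub).trans (measure_biUnion_finset_le _ _)
    _ ≤ ∑ y ∈ N, ENNReal.ofReal (2 * e) := by
        refine Finset.sum_le_sum fun y hy => (measure_union_le _ _).trans ?_
        rw [two_mul, ENNReal.ofReal_add (Real.exp_pos _).le (Real.exp_pos _).le]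
        exact add_le_add (hp.measure_design_upper hρ (hNs y hy).2 hτ0 hτ1 v σ n)
          (hp.measure_design_lower hρ (hNs y hy).2 hτ0 hτ1 v σ n)
    _ = ENNReal.ofReal (N.card * (2 * e)) := by
        rw [Finset.sum_const, nsmul_eq_mul, ENNReal.ofReal_mul (Nat.cast_nonneg _),
          ENNReal.ofReal_natCast]
    _ ≤ ENNReal.ofReal δ := by
        refine ENNReal.ofReal_le_ofReal (le_trans ?_ hexp)
        have he0 : 0 < e := Real.exp_pos _
        gcongr
        exact hNcard.trans (pow_le_pow_right₀ hK1 hV)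

end Tail

/-! ### Self-normalized noise -/

section Noise

variable {d : ℕ}

/-- Given the inputs, `noiseForm v D u` is a centred Gaussian with variance `σ²` times the design
form, so the subtracted term is exactly its log-Laplace transform. The identity needs no control of
the design. -/
lemma lintegral_exp_noise_eq_one (p : Measure (Fin d → ℝ)) [IsProbabilityMeasure p]
    (v u : Fin d → ℝ) (σ : NNReal) (n : ℕ) (θ : ℝ) :
    ∫⁻ D, ENNReal.ofReal (Real.exp (θ * noiseForm v D u -
        θ ^ 2 * σ ^ 2 / 2 * (designMap D u ⬝ᵥ designMap D u)))
      ∂(Measure.pi fun _ : Fin n => linearLaw p v σ) = 1 := by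
  have hu := measurable_dotProduct_left u
  have hv := measurable_dotProduct_left v
  let f : (Fin d → ℝ) × ℝ → ENNReal := fun q => ENNReal.ofReal (Real.exp
    (θ * ((q.2 - v ⬝ᵥ q.1) * (u ⬝ᵥ q.1)) - θ ^ 2 * σ ^ 2 / 2 * (u ⬝ᵥ q.1) ^ 2))
  have hf : Measurable f := by fun_prop
  have h1 : ∀ D : Fin n → (Fin d → ℝ) × ℝ, ENNReal.ofReal (Real.exp (θ * noiseForm v D u -
      θ ^ 2 * σ ^ 2 / 2 * (designMap D u ⬝ᵥ designMap D u))) = ∏ j, f (D j) := fun D => by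
    rw [designMap_dotProduct_self]
    simp only [noiseForm, LinearMap.coe_mk, AddHom.coe_mk, f]
    rw [← ENNReal.ofReal_prod_of_nonneg fun _ _ => (Real.exp_pos _).le, ← Real.exp_sum,
      Finset.sum_sub_distrib, Finset.mul_sum, Finset.mul_sum]
  have h2 : ∫⁻ q, f q ∂(linearLaw p v σ) = 1 := by
    rw [lintegral_linearLaw p v σ hf]
    have : ∀ x, ∫⁻ z, f (x, v ⬝ᵥ x + z) ∂(gaussianReal 0 (σ ^ 2)) = 1 := fun x => by
      have h3 : ∀ z : ℝ, f (x, v ⬝ᵥ x + z) =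
          ENNReal.ofReal (Real.exp (-(θ ^ 2 * σ ^ 2 / 2 * (u ⬝ᵥ x) ^ 2))) *
          ENNReal.ofReal (Real.exp ((θ * (u ⬝ᵥ x)) * z)) := fun z => by
        rw [← ENNReal.ofReal_mul (Real.exp_pos _).le, ← Real.exp_add]
        simp only [f]
        congr 2
        ring
      simp_rw [h3]
      rw [lintegral_const_mul _ (by fun_prop), lintegral_exp_mul_gaussianReal,
        ← ENNReal.ofReal_mul (Real.exp_pos _).le, ← Real.exp_add, ← ENNReal.ofReal_one]
      congr 1
      rw [Real.exp_eq_one_iff]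
      push_cast
      ring
    simp [this]
  simp_rw [h1]
  rw [lintegral_pi_prod (fun _ : Fin n => linearLaw p v σ) (f := fun _ => f) fun _ => hf]
  simp [h2]

/-- Exponential moments of a self-normalized variable on the event that its normalization is
small. -/
lemma lintegral_exp_sq_le_of_self_normalized {Ω : Type*} [MeasurableSpace Ω] {μ : Measure Ω}
    [IsProbabilityMeasure μ] {q S : Ω → ℝ} (hq : Measurable q) (hS : Measurable S) {c : ℝ}
    (hc : 0 < c)
    (h : ∀ θ : ℝ, ∫⁻ ω, ENNReal.ofReal (Real.exp (θ * q ω - θ ^ 2 * c / 2 * S ω)) ∂μ = 1)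
    {Λ : ℝ} (hΛ : 0 < Λ) :
    ∫⁻ ω, {ω | S ω ≤ Λ}.indicator
      (fun ω => ENNReal.ofReal (Real.exp (q ω ^ 2 / (4 * Λ * c)))) ω ∂μ ≤ 2 := by
  -- The free parameter is averaged over `θ = √(2 s) g` with `g` standard Gaussian. This `s` makes
  -- the penalty at `S = Λ` equal to `g² / 4`, so the weight `exp (g² / 4)` pays for it on the event
  -- `S ≤ Λ`. After the swap the inner integral is `1` by `h`.
  set s : ℝ := 1 / (4 * Λ * c) with hs
  have hs0 : 0 < s := by positivity
  have hpt : ∀ ω, {ω | S ω ≤ Λ}.indicator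
        (fun ω => ENNReal.ofReal (Real.exp (q ω ^ 2 / (4 * Λ * c)))) ω ≤
      ∫⁻ g, ENNReal.ofReal (Real.exp (g ^ 2 / 4)) *
        ENNReal.ofReal (Real.exp ((√(2 * s) * g) * q ω - (√(2 * s) * g) ^ 2 * c / 2 * S ω))
          ∂(gaussianReal 0 1) := fun ω => by
    by_cases hD : S ω ≤ Λ
    · rw [Set.indicator_of_mem (by exact hD)]
      have h1 : ENNReal.ofReal (Real.exp (q ω ^ 2 / (4 * Λ * c))) =
          ∫⁻ g, ENNReal.ofReal (Real.exp ((√(2 * s) * q ω) * g)) ∂(gaussianReal 0 1) := by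
        rw [lintegral_exp_mul_gaussianReal, mul_pow, Real.sq_sqrt (by positivity), hs]
        congr 2
        simp only [NNReal.coe_one]
        field_simp
      rw [h1]
      refine lintegral_mono fun g => ?_
      rw [← ENNReal.ofReal_mul (Real.exp_pos _).le, ← Real.exp_add]
      refine ENNReal.ofReal_le_ofReal (Real.exp_le_exp.mpr ?_)
      rw [mul_pow, Real.sq_sqrt (by positivity)]
      have h2 : 2 * s * g ^ 2 * c / 2 * S ω ≤ g ^ 2 / 4 := by
        calc _ ≤ 2 * s * g ^ 2 * c / 2 * Λ := by gcongr
          _ = g ^ 2 / 4 := by rw [hs]; field_simp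
      linarith
    · rw [Set.indicator_of_notMem (by exact hD)]
      exact zero_le
  refine (lintegral_mono hpt).trans ?_
  rw [lintegral_lintegral_swap (by fun_prop)]
  have hin : ∀ g : ℝ, ∫⁻ ω, ENNReal.ofReal (Real.exp (g ^ 2 / 4)) *
        ENNReal.ofReal (Real.exp ((√(2 * s) * g) * q ω - (√(2 * s) * g) ^ 2 * c / 2 * S ω)) ∂μ =
      ENNReal.ofReal (Real.exp (g ^ 2 / 4)) := fun g => by
    rw [lintegral_const_mul _ (by fun_prop), h, mul_one]
  simp_rw [hin]
  exact lintegral_exp_sq_gaussianReal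

lemma lintegral_exp_noise_sq_le (p : Measure (Fin d → ℝ)) [IsProbabilityMeasure p]
    (v u : Fin d → ℝ) {σ : NNReal} (hσ : 0 < σ) {n : ℕ} (hn : 0 < n) {Λ : ℝ} (hΛ : 0 < Λ) :
    ∫⁻ D, {D : Fin n → (Fin d → ℝ) × ℝ | designMap D u ⬝ᵥ designMap D u ≤ Λ * n}.indicator
        (fun D => ENNReal.ofReal (Real.exp (noiseForm v D u ^ 2 / n / (4 * Λ * σ ^ 2)))) D
      ∂(Measure.pi fun _ : Fin n => linearLaw p v σ) ≤ 2 := by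
  have hσ' : (0 : ℝ) < σ := hσ
  have hn' : (0 : ℝ) < n := by exact_mod_cast hn
  have h := lintegral_exp_sq_le_of_self_normalized (measurable_noiseForm (n := n) v u)
    (measurable_designMap_sq (n := n) u) (c := (σ : ℝ) ^ 2) (by positivity)
    (fun θ => lintegral_exp_noise_eq_one p v u σ n θ) (Λ := Λ * n) (by positivity)
  refine le_trans (le_of_eq ?_) h
  congr with D
  congr with D
  congr 2
  field_simp

/-- Tail bound for the noise of several independent tasks in a fixed direction. -/
lemma measure_noise_tail {T : ℕ} (p : Fin T → Measure (Fin d → ℝ))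
    [∀ t, IsProbabilityMeasure (p t)] (v : Fin T → Fin d → ℝ) (u : Fin d → ℝ) {σ : NNReal}
    (hσ : 0 < σ) {n : Fin T → ℕ} (hn : ∀ t, 0 < n t) {Λ : ℝ} (hΛ : 0 < Λ) (s : ℝ) :
    (Measure.pi fun t => Measure.pi fun _ : Fin (n t) => linearLaw (p t) (v t) σ)
        {S | (∀ t, designMap (S t) u ⬝ᵥ designMap (S t) u ≤ Λ * n t) ∧
          4 * Λ * σ ^ 2 * (T + s) ≤ ∑ t, noiseForm (v t) (S t) u ^ 2 / n t} ≤
      ENNReal.ofReal (Real.exp (-s)) := by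
  have hσ' : (0 : ℝ) < σ := hσ
  let f : ∀ t, (Fin (n t) → (Fin d → ℝ) × ℝ) → ENNReal := fun t =>
    {D : Fin (n t) → (Fin d → ℝ) × ℝ | designMap D u ⬝ᵥ designMap D u ≤ Λ * n t}.indicator
      (fun D => ENNReal.ofReal (Real.exp (noiseForm (v t) D u ^ 2 / n t / (4 * Λ * σ ^ 2))))
  have hf : ∀ t, Measurable (f t) := fun t => by
    have hq := measurable_noiseForm (n := n t) (v t) u
    exact Measurable.indicator (by fun_prop)
      (measurableSet_le (measurable_designMap_sq u) measurable_const)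
  have h1 : ∫⁻ S, ∏ t, f t (S t)
      ∂(Measure.pi fun t => Measure.pi fun _ : Fin (n t) => linearLaw (p t) (v t) σ) ≤
      ENNReal.ofReal (Real.exp T) := by
    rw [lintegral_pi_prod _ hf]
    -- Independence across tasks multiplies the bounds `2 ≤ e`; hence the `T` tasks cost an additive
    -- `T` in the tail.
    calc _ ≤ ∏ _t : Fin T, ENNReal.ofReal (Real.exp 1) := by
          refine Finset.prod_le_prod' fun t _ =>
            (lintegral_exp_noise_sq_le (p t) (v t) u hσ (hn t) hΛ).trans ?_
          rw [show (2 : ENNReal) = ENNReal.ofReal 2 by simp]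
          exact ENNReal.ofReal_le_ofReal (by linarith [Real.add_one_le_exp 1])
      _ = _ := by
          rw [Finset.prod_const, Finset.card_univ, Fintype.card_fin,
            ← ENNReal.ofReal_pow (Real.exp_pos _).le, ← Real.exp_nat_mul, mul_one]
  have hm : Measurable fun S : ∀ t, Fin (n t) → (Fin d → ℝ) × ℝ => ∏ t, f t (S t) :=
    Finset.measurable_prod _ fun t _ => (hf t).comp (measurable_pi_apply t)
  refine le_trans (measure_mono fun S hS => ?_)
    ((measure_le_exp_of_lintegral_exp_le hm (s := T + s) h1).trans (le_of_eq (by congr 2; ring)))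
  obtain ⟨hS1, hS2⟩ := hS
  change ENNReal.ofReal (Real.exp (T + s)) ≤ ∏ t, f t (S t)
  have h2 : ∀ t, f t (S t) =
      ENNReal.ofReal (Real.exp (noiseForm (v t) (S t) u ^ 2 / n t / (4 * Λ * σ ^ 2))) :=
    fun t => Set.indicator_of_mem (by exact hS1 t) _
  simp_rw [h2]
  rw [← ENNReal.ofReal_prod_of_nonneg fun _ _ => (Real.exp_pos _).le, ← Real.exp_sum,
    ← Finset.sum_div]
  refine ENNReal.ofReal_le_ofReal (Real.exp_le_exp.mpr ?_)
  rw [le_div_iff₀ (by positivity)]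
  linarith

/-- Tail bound for the noise of a single task in a fixed direction. -/
lemma measure_noise_tail_single (p : Measure (Fin d → ℝ)) [IsProbabilityMeasure p]
    (v u : Fin d → ℝ) {σ : NNReal} (hσ : 0 < σ) {n : ℕ} (hn : 0 < n) {Λ : ℝ} (hΛ : 0 < Λ) (s : ℝ) :
    (Measure.pi fun _ : Fin n => linearLaw p v σ)
        {D | designMap D u ⬝ᵥ designMap D u ≤ Λ * n ∧
          4 * Λ * σ ^ 2 * (1 + s) ≤ noiseForm v D u ^ 2 / n} ≤
      ENNReal.ofReal (Real.exp (-s)) := by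
  have h := measure_noise_tail (T := 1) (fun _ => p) (fun _ => v) u hσ (n := fun _ => n)
    (fun _ => hn) hΛ s
  have hpr : MeasurePreserving (Function.eval (0 : Fin 1))
      (Measure.pi fun _ : Fin 1 => Measure.pi fun _ : Fin n => linearLaw p v σ)
      (Measure.pi fun _ : Fin n => linearLaw p v σ) := measurePreserving_eval _ 0
  have hq := measurable_noiseForm (n := n) v u
  have hms : MeasurableSet {D : Fin n → (Fin d → ℝ) × ℝ | designMap D u ⬝ᵥ designMap D u ≤ Λ * n ∧
      4 * Λ * σ ^ 2 * (1 + s) ≤ noiseForm v D u ^ 2 / n} :=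
    (measurableSet_le (measurable_designMap_sq u) measurable_const).inter
      (measurableSet_le measurable_const ((hq.pow_const 2).div_const _))
  rw [← hpr.measure_preimage hms.nullMeasurableSet]
  refine le_trans (measure_mono fun S hS => ?_) h
  obtain ⟨h1, h2⟩ := hS
  refine ⟨fun t => ?_, ?_⟩
  · obtain rfl : t = 0 := Subsingleton.elim _ _
    exact h1
  · simpa using h2

/-- Passing from tail bounds in fixed directions to a uniform bound on a subspace. -/
lemma measure_uniform_le_of_tail {Ω : Type*} [MeasurableSpace Ω] {μ : Measure Ω} {ι : Type}
    [Fintype ι] (A : Ω → (Fin d → ℝ) →ₗ[ℝ] (ι → ℝ)) (V : Submodule ℝ (Fin d → ℝ)) (G : Ω → Prop)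
    {β : ℝ} (hβ : 0 ≤ β) {T : ℝ} (hT : 0 ≤ T) {r : ℕ} (hr : Module.finrank ℝ V ≤ r) {δ : ℝ}
    (hδ : 0 < δ) (hδ1 : δ ≤ 1)
    (h : ∀ u ∈ V, u ⬝ᵥ u = 1 → ∀ s, μ {ω | G ω ∧ β * (T + s) ≤ A ω u ⬝ᵥ A ω u} ≤
      ENNReal.ofReal (Real.exp (-s))) :
    μ {ω | G ω ∧ ¬ ∀ u ∈ V, A ω u ⬝ᵥ A ω u ≤
        4 * β * (T + 2 * r + Real.log (1 / δ)) * (u ⬝ᵥ u)} ≤ ENNReal.ofReal δ := by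
  obtain ⟨N, hNcard, hNs, hN⟩ := exists_quadratic_net V (η := 1 / 2) (by norm_num) le_rfl
  -- A net of mesh `1/2` has at most `6 ^ r ≤ exp (2 r)` points, and `2 r` cancels their number in
  -- the union bound.
  set s : ℝ := 2 * r + Real.log (1 / δ) with hs
  have hlog : 0 ≤ Real.log (1 / δ) := Real.log_nonneg (by rw [le_div_iff₀ hδ]; linarith)
  have hs0 : 0 ≤ s := by positivity
  have hsub : {ω | G ω ∧ ¬ ∀ u ∈ V, A ω u ⬝ᵥ A ω u ≤
      4 * β * (T + 2 * r + Real.log (1 / δ)) * (u ⬝ᵥ u)} ⊆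
      ⋃ y ∈ N, {ω | G ω ∧ β * (T + s) ≤ A ω y ⬝ᵥ A ω y} := by
    rintro ω ⟨hG, hω⟩
    by_contra hcon
    simp only [Set.mem_iUnion, Set.mem_ofPred_eq, not_exists, not_and, not_le] at hcon
    refine hω fun u hu => ?_
    have hM : (√(β * (T + s))) ^ 2 = β * (T + s) := Real.sq_sqrt (by positivity)
    have := (hN ι (A ω) (√(β * (T + s))) (Real.sqrt_nonneg _) fun y hy => by
      rw [hM]
      exact (hcon y hy hG).le).1 u hu
    rw [mul_pow, hM] at this
    calc _ ≤ _ := this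
      _ = _ := by rw [hs]; ring
  calc _ ≤ ∑ y ∈ N, μ _ := (measure_mono hsub).trans (measure_biUnion_finset_le _ _)
    _ ≤ ∑ y ∈ N, ENNReal.ofReal (Real.exp (-s)) :=
        Finset.sum_le_sum fun y hy => h y (hNs y hy).1 (hNs y hy).2 s
    _ = ENNReal.ofReal (N.card * Real.exp (-s)) := by
        rw [Finset.sum_const, nsmul_eq_mul, ENNReal.ofReal_mul (Nat.cast_nonneg _),
          ENNReal.ofReal_natCast]
    _ ≤ ENNReal.ofReal δ := by
        refine ENNReal.ofReal_le_ofReal ?_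
        have h6 : (6 : ℝ) ≤ Real.exp 2 := by
          have := Real.exp_one_gt_d9
          rw [show (2 : ℝ) = 1 + 1 by norm_num, Real.exp_add]
          nlinarith
        calc N.card * Real.exp (-s) ≤ Real.exp 2 ^ r * Real.exp (-s) := by
              gcongr
              refine hNcard.trans ?_
              norm_num
              exact (pow_le_pow_right₀ (by norm_num) hr).trans
                (pow_le_pow_left₀ (by norm_num) h6 r)
          _ = Real.exp (-Real.log (1 / δ)) := by
              rw [← Real.exp_nat_mul, ← Real.exp_add, hs]
              congr 1
              ring
          _ = δ := by rw [one_div, Real.log_inv, neg_neg, Real.exp_log hδ]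

end Noise

/-! ### Least squares -/

lemma sum_sq_residual_eq {d n : ℕ} (D : Fin n → (Fin d → ℝ) × ℝ) (v u : Fin d → ℝ) :
    ∑ j, ((D j).2 - (v + u) ⬝ᵥ (D j).1) ^ 2 =
      ∑ j, ((D j).2 - v ⬝ᵥ (D j).1) ^ 2 - 2 * noiseForm v D u +
        designMap D u ⬝ᵥ designMap D u := by
  rw [designMap_dotProduct_self]
  simp only [noiseForm, LinearMap.coe_mk, AddHom.coe_mk, Finset.mul_sum]
  rw [← Finset.sum_sub_distrib, ← Finset.sum_add_distrib]
  refine Finset.sum_congr rfl fun j _ => ?_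
  rw [add_dotProduct]
  ring

lemma dotProduct_self_nonneg' {ι : Type*} [Fintype ι] (u : ι → ℝ) : 0 ≤ u ⬝ᵥ u :=
  Finset.sum_nonneg fun i _ => mul_self_nonneg (u i)

lemma dotProduct_sq_le {ι : Type*} [Fintype ι] (u w : ι → ℝ) :
    (u ⬝ᵥ w) ^ 2 ≤ (u ⬝ᵥ u) * (w ⬝ᵥ w) := by
  have := Finset.sum_mul_sq_le_sq_mul_sq Finset.univ u w
  simpa only [dotProduct, ← sq] using this

lemma add_dotProduct_self_le {ι : Type*} [Fintype ι] (u w : ι → ℝ) :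
    (u + w) ⬝ᵥ (u + w) ≤ 2 * (u ⬝ᵥ u + w ⬝ᵥ w) := by
  have h := dotProduct_self_nonneg' (u - w)
  simp only [sub_dotProduct, dotProduct_sub, add_dotProduct, dotProduct_add] at h ⊢
  linarith

/-- Expansion in an orthonormal basis of a subspace. -/
lemma exists_orthonormal_expansion {d : ℕ} (U : Submodule ℝ (Fin d → ℝ)) :
    ∃ e : Fin (Module.finrank ℝ U) → Fin d → ℝ, (∀ i, e i ∈ U) ∧ (∀ i, e i ⬝ᵥ e i = 1) ∧
      ∀ u ∈ U, u = ∑ i, (e i ⬝ᵥ u) • e i := by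
  let f := (WithLp.linearEquiv 2 ℝ (Fin d → ℝ)).symm
  let U' : Submodule ℝ (EuclideanSpace ℝ (Fin d)) := U.map f.toLinearMap
  have hrank : Module.finrank ℝ U' = Module.finrank ℝ U := LinearEquiv.finrank_map_eq f U
  let β := (stdOrthonormalBasis ℝ U').reindex (finCongr hrank)
  refine ⟨fun i => WithLp.ofLp (β i : EuclideanSpace ℝ (Fin d)), fun i => ?_, fun i => ?_,
    fun u hu => ?_⟩
  · obtain ⟨u, hu, h⟩ := (β i).2
    change WithLp.ofLp (β i : EuclideanSpace ℝ (Fin d)) ∈ U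
    rw [← h]
    exact hu
  · have h1 : ‖β i‖ ^ 2 = 1 := by rw [β.norm_eq_one, one_pow]
    rw [← h1]
    exact (norm_toLp_sq _).symm
  · let u' : U' := ⟨f u, Submodule.mem_map_of_mem hu⟩
    have h1 := congrArg (fun z : U' => WithLp.ofLp (z : EuclideanSpace ℝ (Fin d))) (β.sum_repr' u')
    simp only [Submodule.coe_sum, Submodule.coe_smul, WithLp.ofLp_sum, WithLp.ofLp_smul] at h1
    have h2 : ∀ i, inner ℝ (β i) u' = WithLp.ofLp (β i : EuclideanSpace ℝ (Fin d)) ⬝ᵥ u := by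
      intro i
      rw [Submodule.coe_inner, EuclideanSpace.inner_eq_star_dotProduct, dotProduct_comm]
      rfl
    simp_rw [h2] at h1
    exact h1.symm

/-! ### Estimation error of the source tasks -/

/-- Normalized noise of all source tasks in direction `u`. -/
noncomputable def noiseMap {d T : ℕ} {n : Fin T → ℕ} (v : Fin T → Fin d → ℝ)
    (S : SourceData d n) : (Fin d → ℝ) →ₗ[ℝ] (Fin T → ℝ) :=
  LinearMap.pi fun t => (√(n t))⁻¹ • noiseForm (v t) (S t)

lemma noiseMap_dotProduct_self {d T : ℕ} {n : Fin T → ℕ} (v : Fin T → Fin d → ℝ)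
    (S : SourceData d n) (u : Fin d → ℝ) :
    noiseMap v S u ⬝ᵥ noiseMap v S u = ∑ t, noiseForm (v t) (S t) u ^ 2 / n t := by
  simp only [dotProduct, noiseMap, LinearMap.pi_apply, LinearMap.smul_apply, smul_eq_mul]
  refine Finset.sum_congr rfl fun t _ => ?_
  rw [← sq, mul_pow, inv_pow, Real.sq_sqrt (Nat.cast_nonneg _)]
  ring

/-- In an orthonormal basis `e` of `U` the sum pairs the coefficients `√n_t (e i ⬝ᵥ Δ t)` with the
normalized noise in the directions `e i`; Cauchy–Schwarz separates them, and each of the at most `r`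
directions costs `L`. As `hL` holds for all directions, `U` may depend on the data. -/
lemma sum_noiseForm_sq_le {d T r : ℕ} {n : Fin T → ℕ} (hn : ∀ t, 0 < n t)
    (v : Fin T → Fin d → ℝ) (S : SourceData d n) {L : ℝ} (hL0 : 0 ≤ L)
    (hL : ∀ u, noiseMap v S u ⬝ᵥ noiseMap v S u ≤ L * (u ⬝ᵥ u))
    (U : Submodule ℝ (Fin d → ℝ)) (hU : Module.finrank ℝ U ≤ r) (Δ : Fin T → Fin d → ℝ)
    (hΔ : ∀ t, Δ t ∈ U) :
    (∑ t, noiseForm (v t) (S t) (Δ t)) ^ 2 ≤ (∑ t, n t * (Δ t ⬝ᵥ Δ t)) * (r * L) := by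
  obtain ⟨e, -, he1, he⟩ := exists_orthonormal_expansion U
  have hn' : ∀ t, (0 : ℝ) < n t := fun t => by exact_mod_cast hn t
  have h1 : ∀ t, noiseForm (v t) (S t) (Δ t) =
      ∑ i, (√(n t) * (e i ⬝ᵥ Δ t)) * noiseMap v S (e i) t := fun t => by
    conv_lhs => rw [he _ (hΔ t)]
    simp only [map_sum, map_smul, smul_eq_mul, noiseMap, LinearMap.pi_apply, LinearMap.smul_apply]
    refine Finset.sum_congr rfl fun i _ => ?_
    have : √(n t : ℝ) ≠ 0 := (Real.sqrt_pos.mpr (hn' t)).ne'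
    field_simp
  have h2 : ∀ t, ∑ i, (√(n t) * (e i ⬝ᵥ Δ t)) ^ 2 = n t * (Δ t ⬝ᵥ Δ t) := fun t => by
    have : Δ t ⬝ᵥ Δ t = ∑ i, (e i ⬝ᵥ Δ t) ^ 2 := by
      conv_lhs => rw [he _ (hΔ t), sum_dotProduct]
      refine Finset.sum_congr rfl fun i _ => ?_
      rw [smul_dotProduct, ← he _ (hΔ t), smul_eq_mul, sq]
    rw [this, Finset.mul_sum]
    refine Finset.sum_congr rfl fun i _ => ?_
    rw [mul_pow, Real.sq_sqrt (hn' t).le]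
  simp_rw [h1, ← h2]
  rw [← Fintype.sum_prod_type' (f := fun t i => (√(n t) * (e i ⬝ᵥ Δ t)) * noiseMap v S (e i) t),
    ← Fintype.sum_prod_type' (f := fun t i => (√(n t) * (e i ⬝ᵥ Δ t)) ^ 2)]
  refine (Finset.sum_mul_sq_le_sq_mul_sq _ _ _).trans ?_
  refine mul_le_mul_of_nonneg_left ?_ (Finset.sum_nonneg fun _ _ => sq_nonneg _)
  rw [← Finset.univ_product_univ, Finset.sum_product_right]
  calc ∑ i, ∑ t, noiseMap v S (e i) t ^ 2 ≤ ∑ _i : Fin (Module.finrank ℝ U), L := by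
        refine Finset.sum_le_sum fun i _ => ?_
        have := hL (e i)
        rw [he1, mul_one] at this
        simpa only [dotProduct, ← sq] using this
    _ = Module.finrank ℝ U * L := by simp
    _ ≤ r * L := by gcongr

/-- Bound on the weighted estimation error of the source tasks. -/
theorem source_error_le {d T r : ℕ} {n : Fin T → ℕ} (hn : ∀ t, 0 < n t) {a b : ℝ} (ha : 0 < a)
    (v θ : Fin T → Fin d → ℝ) (S : SourceData d n) {L : ℝ} (hL0 : 0 ≤ L)
    (hS : ∀ t, GoodDesign a b ⊤ (S t))
    (hL : ∀ u, noiseMap v S u ⬝ᵥ noiseMap v S u ≤ L * (u ⬝ᵥ u))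
    (U : Submodule ℝ (Fin d → ℝ)) (hU : Module.finrank ℝ U ≤ r) (hΔ : ∀ t, θ t - v t ∈ U)
    (hmin : ∑ t, ∑ j, ((S t j).2 - θ t ⬝ᵥ (S t j).1) ^ 2 ≤
      ∑ t, ∑ j, ((S t j).2 - v t ⬝ᵥ (S t j).1) ^ 2) :
    ∑ t, n t * ((θ t - v t) ⬝ᵥ (θ t - v t)) ≤ 256 / a ^ 2 * (r * L) := by
  set X := ∑ t, (n t : ℝ) * ((θ t - v t) ⬝ᵥ (θ t - v t)) with hX
  have hX0 : 0 ≤ X := Finset.sum_nonneg fun t _ =>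
    mul_nonneg (Nat.cast_nonneg _) (dotProduct_self_nonneg' _)
  set P := ∑ t, noiseForm (v t) (S t) (θ t - v t) with hP
  have h1 : P ^ 2 ≤ X * (r * L) := sum_noiseForm_sq_le hn v S hL0 hL U hU _ hΔ
  -- The basic inequality of least squares: expanding both losses about `v`, the quadratic term is
  -- dominated by the noise term. With `P² ≤ X r L` it gives a quadratic inequality for `X`.
  have h2 : a / 8 * X ≤ 2 * P := by
    have h3 : ∀ t, ∑ j, ((S t j).2 - θ t ⬝ᵥ (S t j).1) ^ 2 = ∑ j, ((S t j).2 - v t ⬝ᵥ (S t j).1) ^ 2 -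
        2 * noiseForm (v t) (S t) (θ t - v t) +
        designMap (S t) (θ t - v t) ⬝ᵥ designMap (S t) (θ t - v t) := fun t => by
      rw [← sum_sq_residual_eq, add_sub_cancel]
    simp_rw [h3] at hmin
    rw [Finset.sum_add_distrib, Finset.sum_sub_distrib, ← Finset.mul_sum] at hmin
    have h4 : a / 8 * X ≤ ∑ t, designMap (S t) (θ t - v t) ⬝ᵥ designMap (S t) (θ t - v t) := by
      rw [hX, Finset.mul_sum]
      refine Finset.sum_le_sum fun t _ => ?_
      have := (hS t (θ t - v t) trivial).1
      linarith
    linarith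
  rcases hX0.eq_or_lt with h0 | h0
  · rw [← h0]
    positivity
  have h3 : (a / 8 * X) ^ 2 ≤ 4 * (X * (r * L)) := by
    have := pow_le_pow_left₀ (by positivity) h2 2
    linarith
  have h4 : X * (a ^ 2 * X) ≤ X * (256 * (r * L)) := by nlinarith
  have h5 := le_of_mul_le_mul_left h4 h0
  rw [div_mul_eq_mul_div, le_div_iff₀ (by positivity)]
  linarith

/-- Coordinatewise Cauchy–Schwarz with weights `√n_t`. The first factor is the objective of the
allocation problem, which is why that problem governs the transfer error. -/
lemma combination_sq_le {d T : ℕ} {n : Fin T → ℕ} (hn : ∀ t, 0 < n t) (ν : Fin T → ℝ)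
    (Δ : Fin T → Fin d → ℝ) :
    (∑ t, ν t • Δ t) ⬝ᵥ (∑ t, ν t • Δ t) ≤
      (∑ t, ν t ^ 2 / n t) * ∑ t, n t * (Δ t ⬝ᵥ Δ t) := by
  have hn' : ∀ t, (0 : ℝ) < n t := fun t => by exact_mod_cast hn t
  calc (∑ t, ν t • Δ t) ⬝ᵥ (∑ t, ν t • Δ t)
      = ∑ i, (∑ t, (ν t / √(n t)) * (√(n t) * Δ t i)) ^ 2 := by
        simp only [dotProduct, Finset.sum_apply, Pi.smul_apply, smul_eq_mul, ← sq]
        refine Finset.sum_congr rfl fun i _ => ?_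
        congr 1
        refine Finset.sum_congr rfl fun t _ => ?_
        have : √(n t : ℝ) ≠ 0 := (Real.sqrt_pos.mpr (hn' t)).ne'
        field_simp
    _ ≤ ∑ i, (∑ t, (ν t / √(n t)) ^ 2) * (∑ t, (√(n t) * Δ t i) ^ 2) :=
        Finset.sum_le_sum fun i _ => Finset.sum_mul_sq_le_sq_mul_sq _ _ _
    _ = _ := by
        rw [← Finset.mul_sum, Finset.sum_comm]
        congr 1
        · refine Finset.sum_congr rfl fun t _ => ?_
          rw [div_pow, Real.sq_sqrt (hn' t).le]
        · refine Finset.sum_congr rfl fun t _ => ?_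
          rw [dotProduct, Finset.mul_sum]
          refine Finset.sum_congr rfl fun i _ => ?_
          rw [mul_pow, Real.sq_sqrt (hn' t).le, sq]

/-- `n_t ≥ c |ν t|` bounds the first factor by `‖ν‖₁ / c`. The tasks at the floor, rounding
included, use at most `T (Nmin + 1) ≤ 2 T Nmin`, half the total by `htot`, so the total is at most
`2 c ‖ν‖₁` and `c` cancels. -/
lemma sum_sq_div_sampleRule_le {T : ℕ} (ν : Fin T → ℝ) {c : ℝ} (hc : 0 < c) {Nmin : ℕ}
    (hN : 0 < Nmin) (htot : (4 : ℝ) * (T * Nmin) ≤ (∑ t, sampleRule ν c Nmin t : ℕ)) :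
    (∑ t, ν t ^ 2 / sampleRule ν c Nmin t) * (∑ t, sampleRule ν c Nmin t : ℕ) ≤
      2 * l1norm ν ^ 2 := by
  have hl0 : 0 ≤ l1norm ν := Finset.sum_nonneg fun _ _ => abs_nonneg _
  have hpos : ∀ t, (0 : ℝ) < sampleRule ν c Nmin t := fun t => by
    have : Nmin ≤ sampleRule ν c Nmin t := le_max_right _ _
    exact_mod_cast hN.trans_le this
  have h1 : ∑ t, ν t ^ 2 / sampleRule ν c Nmin t ≤ l1norm ν / c := by
    rw [l1norm, Finset.sum_div]
    refine Finset.sum_le_sum fun t _ => ?_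
    have h2 : c * |ν t| ≤ sampleRule ν c Nmin t := (Nat.le_ceil _).trans
      (by exact_mod_cast le_max_left ⌈c * |ν t|⌉₊ Nmin)
    rw [div_le_div_iff₀ (hpos t) hc, ← sq_abs]
    nlinarith [abs_nonneg (ν t)]
  have h3 : ((∑ t, sampleRule ν c Nmin t : ℕ) : ℝ) ≤ c * l1norm ν + T * (Nmin + 1) := by
    push_cast
    calc ∑ t, (sampleRule ν c Nmin t : ℝ) ≤ ∑ t, (c * |ν t| + (Nmin + 1)) := by
          refine Finset.sum_le_sum fun t _ => ?_
          have h4 := (Nat.ceil_lt_add_one (show 0 ≤ c * |ν t| by positivity)).le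
          have h5 : 0 ≤ c * |ν t| := by positivity
          rw [sampleRule, Nat.cast_max]
          exact max_le (by linarith [Nat.cast_nonneg (α := ℝ) Nmin]) (by linarith)
      _ = _ := by rw [Finset.sum_add_distrib, ← Finset.mul_sum]; simp [l1norm]; ring
  have hN1 : (1 : ℝ) ≤ Nmin := by exact_mod_cast hN
  have hT0 : (0 : ℝ) ≤ T := Nat.cast_nonneg T
  have h6 : ((∑ t, sampleRule ν c Nmin t : ℕ) : ℝ) ≤ 2 * (c * l1norm ν) := by nlinarith
  calc _ ≤ l1norm ν / c * (2 * (c * l1norm ν)) := by gcongr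
    _ = _ := by field_simp

/-! ### Estimation error of the target task -/

/-- Least squares over a class of linear predictors, compared with any member of the class. -/
theorem target_error_le {d m : ℕ} (hm : 0 < m) {a b : ℝ} (ha : 0 < a) (hb : 0 < b)
    (D : Fin m → (Fin d → ℝ) × ℝ) (V : Submodule ℝ (Fin d → ℝ)) (hD : GoodDesign a b V D)
    (v θ θ₀ : Fin d → ℝ) {L : ℝ} (hL : ∀ u ∈ V, noiseForm v D u ^ 2 / m ≤ L * (u ⬝ᵥ u))
    (h₀ : θ₀ - v ∈ V) (hθ : θ - θ₀ ∈ V) (hL0 : 0 ≤ L)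
    (hmin : ∑ j, ((D j).2 - θ ⬝ᵥ (D j).1) ^ 2 ≤ ∑ j, ((D j).2 - θ₀ ⬝ᵥ (D j).1) ^ 2) :
    (θ - θ₀) ⬝ᵥ (θ - θ₀) ≤
      512 / a ^ 2 * (L / m + 64 * b ^ 2 * ((θ₀ - v) ⬝ᵥ (θ₀ - v))) := by
  have hm' : (0 : ℝ) < m := by exact_mod_cast hm
  set h := θ - θ₀ with hh
  set w := θ₀ - v with hw
  have e1 := sum_sq_residual_eq D v (w + h)
  have e2 := sum_sq_residual_eq D v w
  rw [show v + (w + h) = θ by rw [hw, hh]; abel] at e1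
  rw [show v + w = θ₀ by rw [hw]; abel] at e2
  rw [e1, e2] at hmin
  simp only [map_add, add_dotProduct, dotProduct_add] at hmin
  rw [dotProduct_comm (designMap D h) (designMap D w)] at hmin
  set H := h ⬝ᵥ h with hH
  set R := designMap D w ⬝ᵥ designMap D h with hR
  set P := noiseForm v D h with hP
  have hH0 : 0 ≤ H := dotProduct_self_nonneg' h
  have hW0 : 0 ≤ w ⬝ᵥ w := dotProduct_self_nonneg' w
  -- The terms in `w` alone cancel; the imperfect comparator survives only in the cross term `R`,
  -- controlled by the upper design bound.
  have h1 : m * (a / 8) * H ≤ 2 * (P - R) := by linarith [(hD h hθ).1]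
  have hR2 : R ^ 2 ≤ (8 * b * m * (w ⬝ᵥ w)) * (8 * b * m * H) :=
    (dotProduct_sq_le _ _).trans (mul_le_mul (hD w h₀).2 (hD h hθ).2
      (dotProduct_self_nonneg' _) (by positivity))
  have hP2 : P ^ 2 ≤ L * H * m := by
    have := hL h hθ
    rwa [div_le_iff₀ hm'] at this
  rcases hH0.eq_or_lt with h0 | h0
  · rw [← h0]
    positivity
  have h3 : (m * (a / 8) * H) ^ 2 ≤ 8 * (P ^ 2 + R ^ 2) := by
    have := pow_le_pow_left₀ (by positivity) h1 2
    nlinarith [sq_nonneg (P + R)]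
  have h4 : (m ^ 2 * H) * (a ^ 2 * H) ≤
      (m ^ 2 * H) * (512 * (L / m + 64 * b ^ 2 * (w ⬝ᵥ w))) := by
    have : (m ^ 2 * H) * (512 * (L / m + 64 * b ^ 2 * (w ⬝ᵥ w))) =
        512 * (L * H * m + (8 * b * m * (w ⬝ᵥ w)) * (8 * b * m * H)) := by
      field_simp
      ring
    rw [this]
    nlinarith
  have h5 := le_of_mul_le_mul_left h4 (by positivity)
  rw [div_mul_eq_mul_div, le_div_iff₀ (by positivity)]
  linarith

/-! ### Existence of the empirical minimizer -/

/-- Families of vectors that factor through `ℝ^k` form a closed set. -/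
lemma isClosed_setOf_factors (d k T : ℕ) :
    IsClosed {θ : Fin T → Fin d → ℝ | ∃ (B : Matrix (Fin d) (Fin k) ℝ)
      (W : Matrix (Fin k) (Fin T) ℝ), ∀ t, θ t = B *ᵥ fun i => W i t} := by
  let Φ : (Fin T → Fin d → ℝ) →ₗ[ℝ] ((Fin T → ℝ) →L[ℝ] (Fin d → ℝ)) :=
    { toFun := fun θ => LinearMap.toContinuousLinearMap (Fintype.linearCombination ℝ θ)
      map_add' := fun θ θ' => by
        ext w i
        simp [Fintype.linearCombination_apply, Finset.sum_add_distrib]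
      map_smul' := fun c θ => by
        ext w i
        simp [Fintype.linearCombination_apply, Finset.mul_sum, mul_left_comm] }
  have hΦ : Continuous Φ := LinearMap.continuous_of_finiteDimensional Φ
  -- Factoring through `ℝ^k` means rank at most `k`, and rank at least `k + 1` is an open condition.
  have hopen : IsOpen {θ | ((k + 1 : ℕ) : Cardinal) ≤ (Fintype.linearCombination ℝ θ).rank} :=
    (isOpen_setOfPred_nat_le_rank (𝕜 := ℝ) (E := Fin T → ℝ) (F := Fin d → ℝ) (k + 1)).preimage hΦ
  suffices h : {θ : Fin T → Fin d → ℝ | ∃ (B : Matrix (Fin d) (Fin k) ℝ)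
      (W : Matrix (Fin k) (Fin T) ℝ), ∀ t, θ t = B *ᵥ fun i => W i t} =
      {θ | ((k + 1 : ℕ) : Cardinal) ≤ (Fintype.linearCombination ℝ θ).rank}ᶜ by
    rw [h]
    exact hopen.isClosed_compl
  ext θ
  simp only [Set.mem_ofPred_eq, Set.mem_compl_iff, not_le]
  have hcard : (Fintype.linearCombination ℝ θ).rank < ((k + 1 : ℕ) : Cardinal) ↔
      Module.finrank ℝ (LinearMap.range (Fintype.linearCombination ℝ θ)) ≤ k := by
    rw [LinearMap.rank, ← Module.finrank_eq_rank, Nat.cast_lt, Nat.lt_succ_iff]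
  rw [hcard, Fintype.range_linearCombination]
  constructor
  · rintro ⟨B, W, h⟩
    have hle : Submodule.span ℝ (Set.range θ) ≤ LinearMap.range B.mulVecLin := by
      rw [Submodule.span_le]
      rintro _ ⟨t, rfl⟩
      exact ⟨fun i => W i t, (h t).symm⟩
    refine (Submodule.finrank_mono hle).trans ((LinearMap.finrank_range_le _).trans ?_)
    simp
  · intro h
    obtain ⟨r, g, h, hg⟩ : ∃ (r : ℕ) (g : Fin r → Fin d → ℝ), r ≤ k ∧
        Submodule.span ℝ (Set.range g) = Submodule.span ℝ (Set.range θ) :=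
      let ⟨g, _, hg, _⟩ := Submodule.exists_fun_fin_finrank_span_eq ℝ (Set.range θ)
      ⟨_, g, h, hg⟩
    -- A basis of the span gives the columns, padded by zeros when the rank is below `k`.
    let B : Matrix (Fin d) (Fin k) ℝ := of fun i j => if hj : (j : ℕ) < r then g ⟨j, hj⟩ i else 0
    have hB : ∀ t, ∃ w, B *ᵥ w = θ t := by
      intro t
      have h1 : θ t ∈ Submodule.span ℝ (Set.range g) := by
        rw [hg]
        exact Submodule.subset_span ⟨t, rfl⟩
      have h2 : Submodule.span ℝ (Set.range g) ≤ LinearMap.range B.mulVecLin := by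
        rw [Matrix.range_mulVecLin, Submodule.span_le]
        rintro _ ⟨j, rfl⟩
        refine Submodule.subset_span ⟨⟨j, j.2.trans_le h⟩, ?_⟩
        ext i
        simp [B, Matrix.col]
      exact h2 h1
    choose w hw using hB
    exact ⟨B, of fun i t => w t i, fun t => by simpa using (hw t).symm⟩

lemma sourceLoss_eq {d k T : ℕ} {n : Fin T → ℕ} (S : SourceData d n)
    (q : Matrix (Fin d) (Fin k) ℝ × Matrix (Fin k) (Fin T) ℝ) :
    sourceLoss S q = (1 / (∑ t, n t : ℕ) : ℝ) *
      ∑ t, ∑ j, ((S t j).2 - (q.1 *ᵥ fun i => q.2 i t) ⬝ᵥ (S t j).1) ^ 2 := by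
  simp only [sourceLoss, predict_eq]

/-- Needed because `source_min` only speaks of data for which the minimum is attained. Sublevel sets
in `(B, W)` are unbounded, as only the product matters, so compactness is used for the predictors
`θ`: their admissible set is closed and the well-conditioned design bounds the sublevel set. -/
lemma exists_source_minimizer {d k T : ℕ} {n : Fin T → ℕ} (hn : ∀ t, 0 < n t) {a b : ℝ}
    (ha : 0 < a) (S : SourceData d n) (hS : ∀ t, GoodDesign a b ⊤ (S t)) :
    ∃ q : Matrix (Fin d) (Fin k) ℝ × Matrix (Fin k) (Fin T) ℝ,
      ∀ q' : Matrix (Fin d) (Fin k) ℝ × Matrix (Fin k) (Fin T) ℝ,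
        sourceLoss S q ≤ sourceLoss S q' := by
  let G : (Fin T → Fin d → ℝ) → ℝ := fun θ => ∑ t, ∑ j, ((S t j).2 - θ t ⬝ᵥ (S t j).1) ^ 2
  have hG : Continuous G := by
    simp only [G, dotProduct]
    fun_prop
  let R := {θ : Fin T → Fin d → ℝ | ∃ (B : Matrix (Fin d) (Fin k) ℝ)
      (W : Matrix (Fin k) (Fin T) ℝ), ∀ t, θ t = B *ᵥ fun i => W i t}
  have hR : IsClosed R := isClosed_setOf_factors d k T
  have h0R : (0 : Fin T → Fin d → ℝ) ∈ R := ⟨0, 0, fun t => by simp⟩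
  have hclosed : IsClosed (R ∩ {θ | G θ ≤ G 0}) := hR.inter (isClosed_le hG continuous_const)
  have hG0 : 0 ≤ G 0 := Finset.sum_nonneg fun _ _ => Finset.sum_nonneg fun _ _ => sq_nonneg _
  have hbdd : R ∩ {θ | G θ ≤ G 0} ⊆ Metric.closedBall 0 (√(32 * G 0 / a)) := by
    rintro θ ⟨-, hθ⟩
    have hθ' : G θ ≤ G 0 := hθ
    rw [mem_closedBall_zero_iff, pi_norm_le_iff_of_nonneg (Real.sqrt_nonneg _)]
    intro t
    rw [pi_norm_le_iff_of_nonneg (Real.sqrt_nonneg _)]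
    intro i
    rw [Real.norm_eq_abs]
    refine Real.abs_le_sqrt ?_
    have h1 : ∀ θ' : Fin T → Fin d → ℝ, ∑ j, ((S t j).2 - θ' t ⬝ᵥ (S t j).1) ^ 2 ≤ G θ' :=
      fun θ' => Finset.single_le_sum
        (f := fun t => ∑ j, ((S t j).2 - θ' t ⬝ᵥ (S t j).1) ^ 2)
        (fun _ _ => Finset.sum_nonneg fun _ _ => sq_nonneg _) (Finset.mem_univ t)
    have h2 : designMap (S t) (θ t) ⬝ᵥ designMap (S t) (θ t) ≤ 4 * G 0 := by
      rw [designMap_dotProduct_self]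
      calc ∑ j, (θ t ⬝ᵥ (S t j).1) ^ 2 ≤ ∑ j, 2 * (((S t j).2 - θ t ⬝ᵥ (S t j).1) ^ 2 +
            ((S t j).2 - (0 : Fin T → Fin d → ℝ) t ⬝ᵥ (S t j).1) ^ 2) := by
            refine Finset.sum_le_sum fun j _ => ?_
            simp only [Pi.zero_apply, zero_dotProduct]
            nlinarith [sq_nonneg ((S t j).2 - θ t ⬝ᵥ (S t j).1 + ((S t j).2 - 0))]
        _ ≤ 4 * G 0 := by
            rw [← Finset.mul_sum, Finset.sum_add_distrib]
            linarith [h1 θ, h1 0]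
    have h3 := (hS t (θ t) trivial).1
    have hn1 : (1 : ℝ) ≤ n t := by exact_mod_cast hn t
    have h4 : θ t i ^ 2 ≤ θ t ⬝ᵥ θ t := by
      rw [sq]
      exact Finset.single_le_sum (f := fun i => θ t i * θ t i) (fun _ _ => mul_self_nonneg _)
        (Finset.mem_univ i)
    rw [le_div_iff₀ ha]
    have h5 : 0 ≤ a * (θ t ⬝ᵥ θ t) := mul_nonneg ha.le (dotProduct_self_nonneg' _)
    nlinarith
  have hcomp : IsCompact (R ∩ {θ | G θ ≤ G 0}) :=
    (isCompact_closedBall _ _).of_isClosed_subset hclosed hbdd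
  obtain ⟨θ, ⟨⟨B, W, hBW⟩, hθ0⟩, hmin⟩ := hcomp.exists_isMinOn ⟨0, h0R, le_refl (G 0)⟩
    hG.continuousOn
  have hθ0' : G θ ≤ G 0 := hθ0
  refine ⟨(B, W), fun q' => ?_⟩
  rw [sourceLoss_eq, sourceLoss_eq]
  refine mul_le_mul_of_nonneg_left ?_ (by positivity)
  have h1 : G θ ≤ G fun t => q'.1 *ᵥ fun i => q'.2 i t := by
    by_cases h : G (fun t => q'.1 *ᵥ fun i => q'.2 i t) ≤ G 0
    · exact hmin ⟨⟨q'.1, q'.2, fun t => rfl⟩, h⟩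
    · linarith
  simp only [G, hBW] at h1
  exact h1

/-! ### Excess risk -/

/-- The noise is centred and independent of the input, so its variance cancels and the second moment
of the prediction error remains. -/
lemma excessRisk_le {d k T : ℕ} (M : MTLModel d k T) {a b : ℝ} {ρ : NNReal}
    (hM : IsGoodInput a b ρ M.pTarget) (B : Matrix (Fin d) (Fin k) ℝ) (w : Fin k → ℝ) :
    M.excessRisk B w ≤ b * ((B *ᵥ w - M.B *ᵥ M.wTarget) ⬝ᵥ (B *ᵥ w - M.B *ᵥ M.wTarget)) := by
  have := hM.prob
  set v := M.B *ᵥ M.wTarget with hv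
  have hloss : ∀ (B' : Matrix (Fin d) (Fin k) ℝ) (w' : Fin k → ℝ), M.populationLoss B' w' =
      ∫ x, ((v - B' *ᵥ w') ⬝ᵥ x) ^ 2 ∂M.pTarget +
        ∫ z, z ^ 2 ∂(gaussianReal 0 (M.σ ^ 2)) := by
    intro B' w'
    set u := v - B' *ᵥ w' with hu
    have hum := measurable_dotProduct_left u
    have hvm := measurable_dotProduct_left v
    have hum' := measurable_dotProduct_left (B' *ᵥ w')
    have hi1 : Integrable (fun x => u ⬝ᵥ x) M.pTarget :=
      ((memLp_two_iff_integrable_sq (by fun_prop)).mpr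
        (hM.integrable_dotProduct_sq u)).integrable one_le_two
    have hi2 : MemLp (fun z : ℝ => z) 2 (gaussianReal 0 (M.σ ^ 2)) := memLp_id_gaussianReal 2
    have hz : ∫ z, z ∂(gaussianReal 0 (M.σ ^ 2)) = 0 := integral_id_gaussianReal
    rw [MTLModel.populationLoss, taskLaw_eq, linearLaw, ← hv,
      integral_map (measurable_linearLabel v).aemeasurable
        (by simp only [predict_eq]; fun_prop)]
    have h1 : ∀ q : (Fin d → ℝ) × ℝ, (v ⬝ᵥ q.1 + q.2 - predict B' w' q.1) ^ 2 =
        (u ⬝ᵥ q.1) ^ 2 + q.2 ^ 2 + 2 * ((u ⬝ᵥ q.1) * q.2) := fun q => by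
      rw [predict_eq, hu, sub_dotProduct]
      ring
    simp_rw [h1]
    have hA : Integrable (fun q : (Fin d → ℝ) × ℝ => (u ⬝ᵥ q.1) ^ 2)
        (M.pTarget.prod (gaussianReal 0 (M.σ ^ 2))) := (hM.integrable_dotProduct_sq u).comp_fst _
    have hB : Integrable (fun q : (Fin d → ℝ) × ℝ => q.2 ^ 2)
        (M.pTarget.prod (gaussianReal 0 (M.σ ^ 2))) := hi2.integrable_sq.comp_snd _
    have hC : Integrable (fun q : (Fin d → ℝ) × ℝ => (u ⬝ᵥ q.1) * q.2)
        (M.pTarget.prod (gaussianReal 0 (M.σ ^ 2))) :=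
      hi1.mul_prod (hi2.integrable one_le_two)
    have hAB : Integrable (fun q : (Fin d → ℝ) × ℝ => (u ⬝ᵥ q.1) ^ 2 + q.2 ^ 2)
        (M.pTarget.prod (gaussianReal 0 (M.σ ^ 2))) := hA.add hB
    rw [integral_add hAB (hC.const_mul 2), integral_add hA hB, integral_const_mul,
      integral_prod_mul (fun x => u ⬝ᵥ x) (fun z : ℝ => z), hz,
      integral_fun_fst (fun x => (u ⬝ᵥ x) ^ 2), integral_fun_snd (fun z : ℝ => z ^ 2)]
    simp
  rw [MTLModel.excessRisk, hloss, hloss, ← hv, sub_self]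
  have h2 := hM.integral_sq_le (v - B *ᵥ w)
  rw [← neg_sub (B *ᵥ w) v] at h2 ⊢
  rw [neg_dotProduct_neg] at h2
  simpa using h2

/-! ### High-probability events -/

/-- The favourable event for the source samples. -/
def SourceGood {d T : ℕ} {n : Fin T → ℕ} (a b : ℝ) (v : Fin T → Fin d → ℝ) (L : ℝ)
    (S : SourceData d n) : Prop :=
  (∀ t, GoodDesign a b ⊤ (S t)) ∧ ∀ u, noiseMap v S u ⬝ᵥ noiseMap v S u ≤ L * (u ⬝ᵥ u)

/-- The favourable event for the target samples on a subspace `V`. -/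
def TargetGood {d m : ℕ} (a b : ℝ) (v : Fin d → ℝ) (L : ℝ) (V : Submodule ℝ (Fin d → ℝ))
    (D : TargetData d m) : Prop :=
  GoodDesign a b V D ∧ ∀ u ∈ V, noiseForm v D u ^ 2 / m ≤ L * (u ⬝ᵥ u)

lemma ofReal_half_add_ofReal_half {δ : ℝ} (hδ : 0 < δ) :
    ENNReal.ofReal (δ / 2) + ENNReal.ofReal (δ / 2) = ENNReal.ofReal δ := by
  rw [← ENNReal.ofReal_add (by positivity) (by positivity), add_halves]

/-- Each design may fail with probability `δ / (2T)`, which produces `log (T / δ)`; the uniform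
noise bound takes the other `δ / 2`. -/
theorem exists_sourceGood_const {a b : ℝ} (ha : 0 < a) (hab : a ≤ b) :
    ∃ C : ℝ, 0 < C ∧ ∀ (d T : ℕ) (n : Fin T → ℕ) (ρ σ : NNReal)
      (p : Fin T → Measure (Fin d → ℝ)) (v : Fin T → Fin d → ℝ) (δ : ℝ), 1 ≤ ρ → 0 < σ →
      1 ≤ d → 1 ≤ T → (∀ t, IsGoodInput a b ρ (p t)) → 0 < δ → δ ≤ 1 →
      (∀ t, C * (ρ : ℝ) ^ 4 * (d + Real.log (T / δ)) ≤ n t) → (∀ t, 0 < n t) →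
      (Measure.pi fun t => Measure.pi fun _ : Fin (n t) => linearLaw (p t) (v t) σ)
        {S | ¬ SourceGood a b v (128 * b * σ ^ 2 * (T + 2 * d + Real.log (2 / δ))) S} ≤
        ENNReal.ofReal δ := by
  have hb : 0 < b := ha.trans_le hab
  obtain ⟨C, hC, hdesign⟩ := exists_goodDesign_const ha hab
  refine ⟨2 * C, by positivity, ?_⟩
  intro d T n ρ σ p v δ hρ hσ hd hT hp hδ hδ1 hn hn0
  have := fun t => (hp t).prob
  have hT' : (1 : ℝ) ≤ T := by exact_mod_cast hT
  have hd' : (1 : ℝ) ≤ d := by exact_mod_cast hd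
  set P := Measure.pi fun t => Measure.pi fun _ : Fin (n t) => linearLaw (p t) (v t) σ with hP
  have h1 : ∀ t, P {S | ¬ GoodDesign a b ⊤ (S t)} ≤ ENNReal.ofReal (δ / (2 * T)) := fun t => by
    have hpr := measurePreserving_eval
      (fun t => Measure.pi fun _ : Fin (n t) => linearLaw (p t) (v t) σ) t
    have h2 : P {S | ¬ GoodDesign a b ⊤ (S t)} ≤
        (Measure.pi fun _ : Fin (n t) => linearLaw (p t) (v t) σ) {D | ¬ GoodDesign a b ⊤ D} := by
      -- An inequality suffices here, and it avoids proving measurability of the design event.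
      have := Measure.le_map_apply (μ := P) hpr.measurable.aemeasurable {D | ¬ GoodDesign a b ⊤ D}
      rw [hpr.map_eq] at this
      exact this
    refine h2.trans (hdesign d d (n t) ρ (p t) (v t) σ ⊤ (δ / (2 * T)) hρ (hp t) (by simp) hd
      (by positivity) ?_ ?_)
    · rw [div_le_one (by positivity)]
      linarith
    · refine le_trans ?_ (hn t)
      have h3 : Real.log (1 / (δ / (2 * T))) = Real.log 2 + Real.log (T / δ) := by
        rw [← Real.log_mul (by norm_num) (by positivity)]
        congr 1
        field_simp
      have h4 : 0 ≤ Real.log (T / δ) := Real.log_nonneg (by rw [le_div_iff₀ hδ]; linarith)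
      have h5 : Real.log 2 ≤ 1 := by linarith [Real.log_two_lt_d9]
      rw [h3]
      calc C * (ρ : ℝ) ^ 4 * (d + (Real.log 2 + Real.log (T / δ)))
          ≤ C * (ρ : ℝ) ^ 4 * (2 * (d + Real.log (T / δ))) := by gcongr; linarith
        _ = _ := by ring
  have h2 : P {S | (∀ t, GoodDesign a b ⊤ (S t)) ∧ ¬ ∀ u ∈ (⊤ : Submodule ℝ (Fin d → ℝ)),
      noiseMap v S u ⬝ᵥ noiseMap v S u ≤
        4 * (4 * (8 * b) * σ ^ 2) * (T + 2 * d + Real.log (1 / (δ / 2))) * (u ⬝ᵥ u)} ≤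
      ENNReal.ofReal (δ / 2) := by
    refine measure_uniform_le_of_tail (fun S => noiseMap v S) ⊤ _ (by positivity) (by positivity)
      (by simp) (by positivity) (by linarith) fun u _ hu s => ?_
    refine le_trans (measure_mono fun S hS => ?_)
      (measure_noise_tail p v u hσ hn0 (Λ := 8 * b) (by positivity) s)
    refine ⟨fun t => ?_, ?_⟩
    · have := (hS.1 t u trivial).2
      rwa [hu, mul_one] at this
    · have := hS.2
      rwa [noiseMap_dotProduct_self] at this
  have hsub : {S | ¬ SourceGood a b v (128 * b * σ ^ 2 * (T + 2 * d + Real.log (2 / δ))) S} ⊆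
      (⋃ t, {S : SourceData d n | ¬ GoodDesign a b ⊤ (S t)}) ∪
      {S | (∀ t, GoodDesign a b ⊤ (S t)) ∧ ¬ ∀ u ∈ (⊤ : Submodule ℝ (Fin d → ℝ)),
        noiseMap v S u ⬝ᵥ noiseMap v S u ≤
        4 * (4 * (8 * b) * σ ^ 2) * (T + 2 * d + Real.log (1 / (δ / 2))) * (u ⬝ᵥ u)} := by
    intro S hS
    by_cases hg : ∀ t, GoodDesign a b ⊤ (S t)
    · refine Or.inr ⟨hg, fun h => hS ⟨hg, fun u => ?_⟩⟩
      refine (h u trivial).trans (le_of_eq ?_)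
      rw [one_div_div]
      ring
    · push Not at hg
      exact Or.inl (Set.mem_iUnion.mpr hg)
  refine (measure_mono hsub).trans ((measure_union_le _ _).trans ?_)
  rw [← ofReal_half_add_ofReal_half hδ]
  refine add_le_add ?_ h2
  calc _ ≤ ∑ t, P {S | ¬ GoodDesign a b ⊤ (S t)} := measure_iUnion_fintype_le _ _
    _ ≤ ∑ _t : Fin T, ENNReal.ofReal (δ / (2 * T)) := Finset.sum_le_sum fun t _ => h1 t
    _ = ENNReal.ofReal (δ / 2) := by
      rw [Finset.sum_const, Finset.card_univ, Fintype.card_fin, nsmul_eq_mul,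
        ← ENNReal.ofReal_natCast, ← ENNReal.ofReal_mul (by positivity)]
      congr 1
      field_simp

theorem exists_targetGood_const {a b : ℝ} (ha : 0 < a) (hab : a ≤ b) :
    ∃ C : ℝ, 0 < C ∧ ∀ (d r m : ℕ) (ρ σ : NNReal) (p : Measure (Fin d → ℝ)) (v : Fin d → ℝ)
      (V : Submodule ℝ (Fin d → ℝ)) (δ : ℝ), 1 ≤ ρ → 0 < σ → IsGoodInput a b ρ p →
      Module.finrank ℝ V ≤ r → 1 ≤ r → 0 < δ → δ ≤ 1 →
      C * (ρ : ℝ) ^ 4 * (r + Real.log (1 / δ)) ≤ m → 0 < m →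
      (Measure.pi fun _ : Fin m => linearLaw p v σ)
        {D | ¬ TargetGood a b v (128 * b * σ ^ 2 * (1 + 2 * r + Real.log (2 / δ))) V D} ≤
        ENNReal.ofReal δ := by
  have hb : 0 < b := ha.trans_le hab
  obtain ⟨C, hC, hdesign⟩ := exists_goodDesign_const ha hab
  refine ⟨2 * C, by positivity, ?_⟩
  intro d r m ρ σ p v V δ hρ hσ hp hV hr hδ hδ1 hm hm0
  have := hp.prob
  have hr' : (1 : ℝ) ≤ r := by exact_mod_cast hr
  set P := Measure.pi fun _ : Fin m => linearLaw p v σ with hP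
  have h1 : P {D | ¬ GoodDesign a b V D} ≤ ENNReal.ofReal (δ / 2) := by
    refine hdesign d r m ρ p v σ V (δ / 2) hρ hp hV hr (by positivity) (by linarith) ?_
    refine le_trans ?_ hm
    have h3 : Real.log (1 / (δ / 2)) = Real.log 2 + Real.log (1 / δ) := by
      rw [← Real.log_mul (by norm_num) (by positivity)]
      congr 1
      field_simp
    have h4 : 0 ≤ Real.log (1 / δ) := Real.log_nonneg (by rw [le_div_iff₀ hδ]; linarith)
    have h5 : Real.log 2 ≤ 1 := by linarith [Real.log_two_lt_d9]
    rw [h3]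
    calc C * (ρ : ℝ) ^ 4 * (r + (Real.log 2 + Real.log (1 / δ)))
        ≤ C * (ρ : ℝ) ^ 4 * (2 * (r + Real.log (1 / δ))) := by gcongr; linarith
      _ = _ := by ring
  have hN : ∀ (D : TargetData d m) (u : Fin d → ℝ),
      noiseMap (T := 1) (n := fun _ => m) (fun _ => v) (fun _ => D) u ⬝ᵥ
        noiseMap (T := 1) (n := fun _ => m) (fun _ => v) (fun _ => D) u =
      noiseForm v D u ^ 2 / m := fun D u => by
    rw [noiseMap_dotProduct_self]
    simp
  have h2 : P {D | GoodDesign a b V D ∧ ¬ ∀ u ∈ V,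
      noiseMap (T := 1) (n := fun _ => m) (fun _ => v) (fun _ => D) u ⬝ᵥ
        noiseMap (T := 1) (n := fun _ => m) (fun _ => v) (fun _ => D) u ≤
        4 * (4 * (8 * b) * σ ^ 2) * (1 + 2 * r + Real.log (1 / (δ / 2))) * (u ⬝ᵥ u)} ≤
      ENNReal.ofReal (δ / 2) := by
    refine measure_uniform_le_of_tail
      (fun D => noiseMap (T := 1) (n := fun _ => m) (fun _ => v) (fun _ => D)) V _ (by positivity)
      (by positivity) hV (by positivity) (by linarith) fun u huV hu s => ?_
    refine le_trans (measure_mono fun D hD => ?_)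
      (measure_noise_tail_single p v u hσ hm0 (Λ := 8 * b) (by positivity) s)
    refine ⟨?_, ?_⟩
    · have := (hD.1 u huV).2
      rwa [hu, mul_one] at this
    · have := hD.2
      rwa [hN] at this
  refine (measure_mono fun D hD => ?_).trans ((measure_union_le _ _).trans
    ((add_le_add h1 h2).trans (ofReal_half_add_ofReal_half hδ).le))
  by_cases hg : GoodDesign a b V D
  · refine Or.inr ⟨hg, fun h => hD ⟨hg, fun u hu => ?_⟩⟩
    rw [← hN]
    refine (h u hu).trans (le_of_eq ?_)
    rw [one_div_div]
    ring
  · exact Or.inl hg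

/-! ### Dependence on the learned representation -/

/-- The column space of `B` together with `v`. -/
def targetSpace {d k : ℕ} (B : Matrix (Fin d) (Fin k) ℝ) (v : Fin d → ℝ) :
    Submodule ℝ (Fin d → ℝ) :=
  LinearMap.range B.mulVecLin ⊔ Submodule.span ℝ {v}

lemma finrank_range_mulVecLin_le {d k : ℕ} (B : Matrix (Fin d) (Fin k) ℝ) :
    Module.finrank ℝ (LinearMap.range B.mulVecLin) ≤ k :=
  (LinearMap.finrank_range_le _).trans (by simp)

lemma finrank_targetSpace_le {d k : ℕ} (B : Matrix (Fin d) (Fin k) ℝ) (v : Fin d → ℝ) :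
    Module.finrank ℝ (targetSpace B v) ≤ k + 1 :=
  (Submodule.finrank_add_le_finrank_add_finrank _ _).trans
    (add_le_add (finrank_range_mulVecLin_le B) ((finrank_span_le_card {v}).trans
      (by simp)))

/-- Provides the joint measurability in representation and data needed for Tonelli. Parametrizing
the space by `(w, s)` turns the event into an intersection of closed conditions, although its
dimension varies with `B`. -/
lemma isClosed_setOf_targetGood {d k m : ℕ} (a b : ℝ) (v : Fin d → ℝ) (L : ℝ) :
    IsClosed {x : (Fin d → Fin k → ℝ) × TargetData d m |
      TargetGood a b v L (targetSpace (of x.1) v) x.2} := by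
  have h : {x : (Fin d → Fin k → ℝ) × TargetData d m |
      TargetGood a b v L (targetSpace (of x.1) v) x.2} =
      ⋂ (w : Fin k → ℝ) (s : ℝ), {x | (m * (a / 8) * ((of x.1 *ᵥ w + s • v) ⬝ᵥ (of x.1 *ᵥ w + s • v)) ≤
          ∑ j, ((of x.1 *ᵥ w + s • v) ⬝ᵥ (x.2 j).1) ^ 2) ∧
        (∑ j, ((of x.1 *ᵥ w + s • v) ⬝ᵥ (x.2 j).1) ^ 2 ≤
          8 * b * m * ((of x.1 *ᵥ w + s • v) ⬝ᵥ (of x.1 *ᵥ w + s • v))) ∧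
        (∑ j, ((x.2 j).2 - v ⬝ᵥ (x.2 j).1) * ((of x.1 *ᵥ w + s • v) ⬝ᵥ (x.2 j).1)) ^ 2 / m ≤
          L * ((of x.1 *ᵥ w + s • v) ⬝ᵥ (of x.1 *ᵥ w + s • v))} := by
    ext x
    simp only [Set.mem_iInter, Set.mem_ofPred_eq, TargetGood, GoodDesign,
      designMap_dotProduct_self]
    constructor
    · rintro ⟨h1, h2⟩ w s
      have hu : of x.1 *ᵥ w + s • v ∈ targetSpace (of x.1) v :=
        Submodule.add_mem_sup ⟨w, rfl⟩ (Submodule.smul_mem _ _ (Submodule.mem_span_singleton_self v))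
      exact ⟨(h1 _ hu).1, (h1 _ hu).2, h2 _ hu⟩
    · intro h
      have h' : ∀ u ∈ targetSpace (of x.1) v, ∃ (w : Fin k → ℝ) (s : ℝ), of x.1 *ᵥ w + s • v = u := by
        intro u hu
        obtain ⟨y, ⟨w, rfl⟩, z, hz, rfl⟩ := Submodule.mem_sup.mp hu
        obtain ⟨s, rfl⟩ := Submodule.mem_span_singleton.mp hz
        exact ⟨w, s, rfl⟩
      constructor
      · intro u hu
        obtain ⟨w, s, rfl⟩ := h' u hu
        exact ⟨(h w s).1, (h w s).2.1⟩
      · intro u hu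
        obtain ⟨w, s, rfl⟩ := h' u hu
        exact (h w s).2.2
  rw [h]
  refine isClosed_iInter fun w => isClosed_iInter fun s => ?_
  have hU : Continuous fun x : (Fin d → Fin k → ℝ) × TargetData d m => of x.1 *ᵥ w + s • v := by
    refine continuous_pi fun i => ?_
    simp only [Pi.add_apply, mulVec, dotProduct, of_apply]
    fun_prop
  have hUU := hU.dotProduct hU
  have hX : ∀ j, Continuous fun x : (Fin d → Fin k → ℝ) × TargetData d m => (x.2 j).1 :=
    fun j => by fun_prop
  have hY : ∀ j, Continuous fun x : (Fin d → Fin k → ℝ) × TargetData d m => (x.2 j).2 :=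
    fun j => by fun_prop
  have hUX := fun j => hU.dotProduct (hX j)
  have hVX := fun j => (continuous_const (y := v)).dotProduct (hX j)
  have hS : Continuous fun x : (Fin d → Fin k → ℝ) × TargetData d m =>
      ∑ j, ((of x.1 *ᵥ w + s • v) ⬝ᵥ (x.2 j).1) ^ 2 :=
    continuous_finsetSum _ fun j _ => (hUX j).pow 2
  have hQ : Continuous fun x : (Fin d → Fin k → ℝ) × TargetData d m =>
      ∑ j, ((x.2 j).2 - v ⬝ᵥ (x.2 j).1) * ((of x.1 *ᵥ w + s • v) ⬝ᵥ (x.2 j).1) :=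
    continuous_finsetSum _ fun j _ => ((hY j).sub (hVX j)).mul (hUX j)
  exact (isClosed_le (hUU.const_mul _) hS).inter ((isClosed_le hS (hUU.const_mul _)).inter
    (isClosed_le ((hQ.pow 2).div_const _) (hUU.const_mul _)))

/-! ### Sample complexity -/

lemma targetLoss_eq {d k m : ℕ} (D : TargetData d m) (B : Matrix (Fin d) (Fin k) ℝ)
    (w : Fin k → ℝ) :
    targetLoss D B w = (1 / (m : ℝ)) * ∑ j, ((D j).2 - (B *ᵥ w) ⬝ᵥ (D j).1) ^ 2 := by
  simp only [targetLoss, predict_eq]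

lemma mulVec_mulVec_eq_sum {d k T : ℕ} (B : Matrix (Fin d) (Fin k) ℝ)
    (W : Matrix (Fin k) (Fin T) ℝ) (ν : Fin T → ℝ) :
    B *ᵥ (W *ᵥ ν) = ∑ t, ν t • (B *ᵥ fun i => W i t) := by
  have : W *ᵥ ν = ∑ t, ν t • fun i => W i t := by
    ext i
    simp [mulVec, dotProduct, mul_comm]
  rw [this, mulVec_sum]
  simp only [mulVec_smul]

/-- Deterministic bound on the excess risk on the favourable events. -/
theorem excessRisk_le_of_good {d k T m : ℕ} {n : Fin T → ℕ} (hn : ∀ t, 0 < n t) (hm : 0 < m)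
    {a b : ℝ} {ρ : NNReal} (ha : 0 < a) (hb : 0 < b) (M : MTLModel d k T)
    (hM : IsGoodInput a b ρ M.pTarget) {ν : Fin T → ℝ} (hν : M.W *ᵥ ν = M.wTarget)
    {Bhat : SourceData d n → Matrix (Fin d) (Fin k) ℝ}
    {What : SourceData d n → Matrix (Fin k) (Fin T) ℝ}
    {what : SourceData d n → TargetData d m → Fin k → ℝ}
    (hl : IsTransferLearner n m Bhat What what) {S : SourceData d n} {D : TargetData d m}
    {L₁ L₂ A : ℝ} (hL₁ : 0 ≤ L₁) (hL₂ : 0 ≤ L₂)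
    (hS : SourceGood a b (fun t => M.B *ᵥ fun i => M.W i t) L₁ S)
    (hD : TargetGood a b (M.B *ᵥ M.wTarget) L₂
      (targetSpace (Bhat S) (M.B *ᵥ M.wTarget)) D)
    (hA : ∑ t, ν t ^ 2 / n t ≤ A) :
    M.excessRisk (Bhat S) (what S D) ≤
      2 * b * (A * (256 / a ^ 2 * (2 * k * L₁)) +
        512 / a ^ 2 * (L₂ / m + 64 * b ^ 2 * (A * (256 / a ^ 2 * (2 * k * L₁))))) := by
  set v : Fin T → Fin d → ℝ := fun t => M.B *ᵥ fun i => M.W i t with hv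
  set vT := M.B *ᵥ M.wTarget with hvT
  set θ : Fin T → Fin d → ℝ := fun t => Bhat S *ᵥ fun i => What S i t with hθ
  have hm' : (0 : ℝ) < m := by exact_mod_cast hm
  have hsum : 0 ≤ ∑ t, ν t ^ 2 / (n t : ℝ) := Finset.sum_nonneg fun t _ => by positivity
  have hmin : ∑ t, ∑ j, ((S t j).2 - θ t ⬝ᵥ (S t j).1) ^ 2 ≤
      ∑ t, ∑ j, ((S t j).2 - v t ⬝ᵥ (S t j).1) ^ 2 := by
    rcases Nat.eq_zero_or_pos T with rfl | hT
    · simp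
    have h := hl.source_min S (exists_source_minimizer hn ha S hS.1) (M.B, M.W)
    rw [sourceLoss_eq, sourceLoss_eq] at h
    have hN : 0 < ∑ t, n t :=
      Finset.sum_pos (fun t _ => hn t) ⟨⟨0, hT⟩, Finset.mem_univ _⟩
    exact le_of_mul_le_mul_left h (by positivity)
  let U := LinearMap.range (Bhat S).mulVecLin ⊔ LinearMap.range M.B.mulVecLin
  have hU : Module.finrank ℝ U ≤ 2 * k :=
    (Submodule.finrank_add_le_finrank_add_finrank _ _).trans (by
      have h1 := finrank_range_mulVecLin_le (Bhat S)
      have h2 := finrank_range_mulVecLin_le M.B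
      omega)
  have hΔ : ∀ t, θ t - v t ∈ U := fun t => Submodule.sub_mem _
    (Submodule.mem_sup_left ⟨_, rfl⟩) (Submodule.mem_sup_right ⟨_, rfl⟩)
  have herr := source_error_le hn ha v θ S hL₁ hS.1 hS.2 U hU hΔ hmin
  push_cast at herr
  set V₀ := A * (256 / a ^ 2 * (2 * k * L₁)) with hV₀
  -- The head `What S *ᵥ ν` is the comparator: since `M.W *ᵥ ν` is the true head, its error is the
  -- `ν`-combination of the source errors.
  have hθ₀ : Bhat S *ᵥ (What S *ᵥ ν) - vT = ∑ t, ν t • (θ t - v t) := by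
    rw [hvT, ← hν, mulVec_mulVec_eq_sum, mulVec_mulVec_eq_sum, ← Finset.sum_sub_distrib]
    simp only [smul_sub, hθ, hv]
  have hw : (Bhat S *ᵥ (What S *ᵥ ν) - vT) ⬝ᵥ (Bhat S *ᵥ (What S *ᵥ ν) - vT) ≤ V₀ := by
    rw [hθ₀]
    refine (combination_sq_le hn ν _).trans (mul_le_mul hA herr ?_ (hsum.trans hA))
    exact Finset.sum_nonneg fun t _ =>
      mul_nonneg (Nat.cast_nonneg _) (dotProduct_self_nonneg' _)
  have hminT : ∑ j, ((D j).2 - (Bhat S *ᵥ what S D) ⬝ᵥ (D j).1) ^ 2 ≤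
      ∑ j, ((D j).2 - (Bhat S *ᵥ (What S *ᵥ ν)) ⬝ᵥ (D j).1) ^ 2 := by
    have h := hl.target_min S D (What S *ᵥ ν)
    rw [targetLoss_eq, targetLoss_eq] at h
    exact le_of_mul_le_mul_left h (by positivity)
  -- Including the true predictor in `targetSpace` puts the comparator error in the space where the
  -- design is controlled.
  have hh := target_error_le hm ha hb D _ hD.1 vT _ _ hD.2
    (Submodule.sub_mem _ (Submodule.mem_sup_left ⟨What S *ᵥ ν, rfl⟩)
      (Submodule.mem_sup_right (Submodule.mem_span_singleton_self _)))
    (Submodule.sub_mem _ (Submodule.mem_sup_left ⟨what S D, rfl⟩)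
      (Submodule.mem_sup_left ⟨What S *ᵥ ν, rfl⟩)) hL₂ hminT
  simp only [mulVecLin_apply] at hh
  have hsplit := add_dotProduct_self_le (Bhat S *ᵥ what S D - Bhat S *ᵥ (What S *ᵥ ν))
    (Bhat S *ᵥ (What S *ᵥ ν) - vT)
  rw [sub_add_sub_cancel] at hsplit
  refine (excessRisk_le M hM (Bhat S) (what S D)).trans ?_
  rw [mul_comm 2 b, mul_assoc]
  refine mul_le_mul_of_nonneg_left (hsplit.trans ?_) hb.le
  refine mul_le_mul_of_nonneg_left ?_ two_pos.le
  rw [add_comm]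
  refine add_le_add hw (hh.trans ?_)
  gcongr

/-- The favourable events hold simultaneously with high probability. -/
theorem exists_good_events_const {a b : ℝ} (ha : 0 < a) (hab : a ≤ b) :
    ∃ C : ℝ, 0 < C ∧ ∀ (d k T m : ℕ) (n : Fin T → ℕ) (ρ : NNReal) (M : MTLModel d k T) (δ : ℝ)
      (Bhat : SourceData d n → Matrix (Fin d) (Fin k) ℝ), 1 ≤ ρ → 0 < M.σ →
      1 ≤ d → 1 ≤ T → 1 ≤ k → M.Admissible a b ρ → 0 < δ → δ ≤ 1 →
      (∀ i j, Measurable fun S => Bhat S i j) →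
      (∀ t, C * (ρ : ℝ) ^ 4 * (d + Real.log (T / δ)) ≤ n t) → (∀ t, 0 < n t) →
      C * (ρ : ℝ) ^ 4 * (k + Real.log (1 / δ)) ≤ m → 0 < m →
      M.dataLaw n m {ω | ¬ (SourceGood a b (fun t => M.B *ᵥ fun i => M.W i t)
          (128 * b * M.σ ^ 2 * (T + 2 * d + Real.log (4 / δ))) ω.1 ∧
        TargetGood a b (M.B *ᵥ M.wTarget)
          (128 * b * M.σ ^ 2 * (1 + 2 * (k + 1) + Real.log (4 / δ)))
          (targetSpace (Bhat ω.1) (M.B *ᵥ M.wTarget)) ω.2)} ≤ ENNReal.ofReal δ := by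
  obtain ⟨C₁, hC₁, hsource⟩ := exists_sourceGood_const ha hab
  obtain ⟨C₂, hC₂, htarget⟩ := exists_targetGood_const ha hab
  refine ⟨2 * C₁ + 3 * C₂, by positivity, ?_⟩
  intro d k T m n ρ M δ Bhat hρ hσ hd hT hk hM hδ hδ1 hB hn hn0 hm hm0
  have := fun t => (hM.source t).prob
  have := hM.target.prob
  have hd' : (1 : ℝ) ≤ d := by exact_mod_cast hd
  have hT' : (1 : ℝ) ≤ T := by exact_mod_cast hT
  have hk' : (1 : ℝ) ≤ k := by exact_mod_cast hk
  have hlog2 : Real.log 2 ≤ 1 := by linarith [Real.log_two_lt_d9]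
  have h4 : 2 / (δ / 2) = 4 / δ := by
    field_simp
    norm_num
  set v : Fin T → Fin d → ℝ := fun t => M.B *ᵥ fun i => M.W i t with hv
  set vT := M.B *ᵥ M.wTarget with hvT
  set L₁ := 128 * b * M.σ ^ 2 * (T + 2 * d + Real.log (4 / δ)) with hL₁
  set L₂ := 128 * b * M.σ ^ 2 * (1 + 2 * (k + 1) + Real.log (4 / δ)) with hL₂
  have hlaw : M.dataLaw n m =
      (Measure.pi fun t => Measure.pi fun _ : Fin (n t) => linearLaw (M.p t) (v t) M.σ).prod
        (Measure.pi fun _ : Fin m => linearLaw M.pTarget vT M.σ) := by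
    simp only [MTLModel.dataLaw, taskLaw_eq, hv, hvT]
  rw [hlaw]
  set P := Measure.pi fun t => Measure.pi fun _ : Fin (n t) => linearLaw (M.p t) (v t) M.σ
  set P' := Measure.pi fun _ : Fin m => linearLaw M.pTarget vT M.σ
  have h1 : (P.prod P') {ω | ¬ SourceGood a b v L₁ ω.1} ≤ ENNReal.ofReal (δ / 2) := by
    have h2 : {ω : SourceData d n × TargetData d m | ¬ SourceGood a b v L₁ ω.1} =
        {S | ¬ SourceGood a b v L₁ S} ×ˢ Set.univ := by
      ext ω
      simp
    rw [h2, Measure.prod_prod, measure_univ, mul_one]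
    have h3 := hsource d T n ρ M.σ M.p v (δ / 2) hρ hσ hd hT hM.source (by positivity)
      (by linarith) (fun t => ?_) hn0
    · rw [h4] at h3
      exact h3
    · refine le_trans ?_ (hn t)
      have h5 : Real.log (T / (δ / 2)) = Real.log 2 + Real.log (T / δ) := by
        rw [← Real.log_mul (by norm_num) (by positivity)]
        congr 1
        field_simp
      have h6 : 0 ≤ Real.log (T / δ) := Real.log_nonneg (by rw [le_div_iff₀ hδ]; linarith)
      rw [h5]
      calc C₁ * (ρ : ℝ) ^ 4 * (d + (Real.log 2 + Real.log (T / δ)))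
          ≤ C₁ * (ρ : ℝ) ^ 4 * (2 * (d + Real.log (T / δ))) := by gcongr; linarith
        _ = 2 * C₁ * (ρ : ℝ) ^ 4 * (d + Real.log (T / δ)) := by ring
        _ ≤ _ := by gcongr; linarith
  have hmeas : MeasurableSet {ω : SourceData d n × TargetData d m |
      ¬ TargetGood a b vT L₂ (targetSpace (Bhat ω.1) vT) ω.2} := by
    have hf : Measurable fun ω : SourceData d n × TargetData d m =>
        ((fun i j => Bhat ω.1 i j : Fin d → Fin k → ℝ), ω.2) :=
      Measurable.prodMk (measurable_pi_lambda _ fun i => measurable_pi_lambda _ fun j =>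
        (hB i j).comp measurable_fst) measurable_snd
    exact (hf (isClosed_setOf_targetGood a b vT L₂).measurableSet).compl
  have h2 : (P.prod P') {ω | ¬ TargetGood a b vT L₂ (targetSpace (Bhat ω.1) vT) ω.2} ≤
      ENNReal.ofReal (δ / 2) := by
    -- For fixed source data the learned space is deterministic and independent of the target
    -- samples, so the bound for a fixed subspace applies slice by slice.
    rw [Measure.prod_apply hmeas]
    calc _ ≤ ∫⁻ _S, ENNReal.ofReal (δ / 2) ∂P := by
          refine lintegral_mono fun S => ?_
          have h3 := htarget d (k + 1) m ρ M.σ M.pTarget vT (targetSpace (Bhat S) vT) (δ / 2) hρ hσ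
            hM.target (finrank_targetSpace_le _ _) (by omega) (by positivity) (by linarith) ?_ hm0
          · rw [h4] at h3
            push_cast at h3
            exact h3
          · refine le_trans ?_ hm
            have h5 : Real.log (1 / (δ / 2)) = Real.log 2 + Real.log (1 / δ) := by
              rw [← Real.log_mul (by norm_num) (by positivity)]
              congr 1
              field_simp
            have h6 : 0 ≤ Real.log (1 / δ) := Real.log_nonneg (by rw [le_div_iff₀ hδ]; linarith)
            rw [h5]
            push_cast
            calc C₂ * (ρ : ℝ) ^ 4 * (k + 1 + (Real.log 2 + Real.log (1 / δ)))
                ≤ C₂ * (ρ : ℝ) ^ 4 * (3 * (k + Real.log (1 / δ))) := by gcongr; linarith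
              _ = 3 * C₂ * (ρ : ℝ) ^ 4 * (k + Real.log (1 / δ)) := by ring
              _ ≤ _ := by gcongr; linarith
      _ = _ := by simp
  refine (measure_mono fun ω hω => ?_).trans ((measure_union_le _ _).trans
    ((add_le_add h1 h2).trans (ofReal_half_add_ofReal_half hδ).le))
  by_cases hg : SourceGood a b v L₁ ω.1
  · exact Or.inr fun h => hω ⟨hg, h⟩
  · exact Or.inl hg

/-- Arithmetic of the constants in the sample complexity bound. -/
lemma risk_bound_arith {a b C d k T ℓ N Q s m ε l : ℝ} (ha : 0 < a) (hb : 0 < b) (hC : 0 < C)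
    (hd : 1 ≤ d) (hk : 1 ≤ k) (hT : 1 ≤ T) (hN : 0 < N) (hs : 0 < s) (hm : 0 < m)
    (hε : 0 < ε) (hl : 0 ≤ l)
    (hCval : 2 * b * (393216 * b / a ^ 2 + 512 / a ^ 2 *
      (896 * b + 64 * b ^ 2 * (393216 * b / a ^ 2))) ≤ C)
    (hQ : Q = s * (k * d + k * T) * ℓ ^ 2 / ε ^ 2) (hNQ : C * Q * (1 + l) ≤ N)
    (hm' : C * (s * k / ε ^ 2) * (1 + l) ≤ m) :
    2 * b * (2 * ℓ ^ 2 / N * (256 / a ^ 2 * (2 * k * (128 * b * s * (T + 2 * d + (2 + l))))) +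
      512 / a ^ 2 * (128 * b * s * (1 + 2 * (k + 1) + (2 + l)) / m +
        64 * b ^ 2 * (2 * ℓ ^ 2 / N *
          (256 / a ^ 2 * (2 * k * (128 * b * s * (T + 2 * d + (2 + l)))))))) ≤ ε ^ 2 := by
  set V := 2 * ℓ ^ 2 / N * (256 / a ^ 2 * (2 * k * (128 * b * s * (T + 2 * d + (2 + l))))) with hV
  have hQε : Q * ε ^ 2 = s * (k * d + k * T) * ℓ ^ 2 := by
    rw [hQ]
    field_simp
  -- `393216 = 2 · 256 · 2 · 128 · 3`, the last factor coming from `h1`.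
  have hV1 : V ≤ 393216 * b / a ^ 2 * (ε ^ 2 / C) := by
    have h1 : T + 2 * d + (2 + l) ≤ 3 * (d + T) * (1 + l) := by nlinarith
    calc V ≤ 2 * ℓ ^ 2 / N * (256 / a ^ 2 * (2 * k * (128 * b * s * (3 * (d + T) * (1 + l))))) := by
          rw [hV]; gcongr
      _ = 393216 * b / a ^ 2 * ((Q * ε ^ 2) * (1 + l) / N) := by
          rw [hQε]
          ring
      _ ≤ 393216 * b / a ^ 2 * (ε ^ 2 / C) := by
          refine mul_le_mul_of_nonneg_left ?_ (by positivity)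
          rw [div_le_div_iff₀ hN hC]
          nlinarith [sq_nonneg ε]
  have hL : 128 * b * s * (1 + 2 * (k + 1) + (2 + l)) / m ≤ 896 * b * (ε ^ 2 / C) := by
    have h1 : 1 + 2 * (k + 1) + (2 + l) ≤ 7 * k * (1 + l) := by nlinarith
    have h2 : s * k * (1 + l) * C ≤ ε ^ 2 * m := by
      have : C * (s * k / ε ^ 2) * (1 + l) = s * k * (1 + l) * C / ε ^ 2 := by ring
      rw [this, div_le_iff₀ (by positivity)] at hm'
      linarith
    calc _ ≤ 128 * b * s * (7 * k * (1 + l)) / m := by gcongr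
      _ = 896 * b * (s * k * (1 + l) / m) := by ring
      _ ≤ 896 * b * (ε ^ 2 / C) := by
          refine mul_le_mul_of_nonneg_left ?_ (by positivity)
          rw [div_le_div_iff₀ hm hC]
          exact h2
  calc _ ≤ 2 * b * (393216 * b / a ^ 2 * (ε ^ 2 / C) + 512 / a ^ 2 * (896 * b * (ε ^ 2 / C) +
        64 * b ^ 2 * (393216 * b / a ^ 2 * (ε ^ 2 / C)))) := by gcongr
    _ = 2 * b * (393216 * b / a ^ 2 + 512 / a ^ 2 *
      (896 * b + 64 * b ^ 2 * (393216 * b / a ^ 2))) * (ε ^ 2 / C) := by ring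
    _ ≤ C * (ε ^ 2 / C) := by gcongr
    _ = ε ^ 2 := by field_simp

theorem sample_complexity (a b : ℝ) (ha : 0 < a) (hab : a ≤ b) : ∃ C : ℝ, 0 < C ∧
      ∀ (d k T : ℕ), 1 ≤ k → k ≤ T → T < d →
      ∀ (ρ : NNReal), 1 ≤ ρ →
      ∀ (M : MTLModel d k T), M.Admissible a b ρ →
      ∀ (ν : Fin T → ℝ), M.W *ᵥ ν = M.wTarget →
      ∀ (δ ε : ℝ), 0 < δ → δ < 1 → 0 < ε →
      ∀ (Nmin : ℕ), C * (ρ : ℝ) ^ 4 * (d + Real.log (T / δ)) ≤ Nmin →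
      ε ^ 2 ≤ min 1 ((M.σ : ℝ) ^ 2 * (k * d + k * T) * l1norm ν ^ 2 / (T * Nmin)) →
      ∀ (c : ℝ), 0 < c →
      C * sourceSize d k M.σ ν ε * (1 + Real.log (sourceSize d k M.σ ν ε / δ)) ≤
        (∑ t, sampleRule ν c Nmin t : ℕ) →
      ∀ (m : ℕ), C * (ρ : ℝ) ^ 4 * (k + Real.log (1 / δ)) ≤ m →
      C * ((M.σ : ℝ) ^ 2 * k / ε ^ 2) * (1 + Real.log (1 / δ)) ≤ m →
      ∀ (Bhat : SourceData d (sampleRule ν c Nmin) → Matrix (Fin d) (Fin k) ℝ)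
        (What : SourceData d (sampleRule ν c Nmin) → Matrix (Fin k) (Fin T) ℝ)
        (what : SourceData d (sampleRule ν c Nmin) → TargetData d m → Fin k → ℝ),
        IsTransferLearner (sampleRule ν c Nmin) m Bhat What what →
        M.dataLaw (sampleRule ν c Nmin) m
          {ω | ¬ M.excessRisk (Bhat ω.1) (what ω.1 ω.2) ≤ ε ^ 2} ≤ ENNReal.ofReal δ := by
  have hb : 0 < b := ha.trans_le hab
  obtain ⟨C₀, hC₀, hgood⟩ := exists_good_events_const ha hab
  set c₁ := 2 * b * (393216 * b / a ^ 2 + 512 / a ^ 2 *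
      (896 * b + 64 * b ^ 2 * (393216 * b / a ^ 2))) with hc₁
  have hc₁0 : 0 < c₁ := by positivity
  -- The summands serve respectively the total `N_tot ≥ 4 T Nmin`, the favourable events, and the
  -- final risk bound.
  refine ⟨4 + C₀ + c₁, by positivity, ?_⟩
  set C := 4 + C₀ + c₁ with hC
  have hCpos : 0 < C := by positivity
  intro d k T hk hkT hTd ρ hρ M hM ν hν δ ε hδ hδ1 hε Nmin hNmin hε1 c hc hN m hm1 hm2 Bhat What
    what hl
  have hk' : (1 : ℝ) ≤ k := by exact_mod_cast hk
  have hT' : (1 : ℝ) ≤ T := by exact_mod_cast hk.trans hkT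
  have hd' : (1 : ℝ) ≤ d := by exact_mod_cast (hk.trans hkT).trans hTd.le
  have hρ' : (1 : ℝ) ≤ ρ := by exact_mod_cast hρ
  have hl1 : 0 ≤ Real.log (1 / δ) := Real.log_nonneg (by rw [le_div_iff₀ hδ]; linarith)
  have hlT : 0 ≤ Real.log (T / δ) := Real.log_nonneg (by rw [le_div_iff₀ hδ]; linarith)
  have hNmin0 : (0 : ℝ) < Nmin := lt_of_lt_of_le (by positivity) hNmin
  have hNmin1 : (1 : ℝ) ≤ Nmin := by
    have : 0 < Nmin := by exact_mod_cast hNmin0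
    exact_mod_cast this
  have hm0 : (0 : ℝ) < m := lt_of_lt_of_le (by positivity) hm1
  have hm0' : 0 < m := by exact_mod_cast hm0
  set Q := sourceSize d k M.σ ν ε with hQ
  have hQdef : Q = (M.σ : ℝ) ^ 2 * (k * d + k * T) * l1norm ν ^ 2 / ε ^ 2 := rfl
  have hε2 := hε1.trans (min_le_right _ _)
  -- The upper bound on `ε²`, rearranged. It forces `Q ≥ 1`, hence positive noise and `log (1/δ) ≤
  -- log (Q/δ)`, and makes the budget exceed the floor `T Nmin`.
  have hTQ : T * Nmin ≤ Q := by
    rw [le_div_iff₀ (by positivity)] at hε2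
    rw [hQdef, le_div_iff₀ (by positivity)]
    linarith
  have hTN1 : (1 : ℝ) ≤ T * Nmin := one_le_mul_of_one_le_of_one_le hT' hNmin1
  have hσ : 0 < M.σ := by
    rw [pos_iff_ne_zero]
    intro h
    rw [hQdef, h] at hTQ
    simp at hTQ
    linarith
  have hQ1 : 1 ≤ Q := hTN1.trans hTQ
  have hlogQ : Real.log (1 / δ) ≤ Real.log (Q / δ) :=
    Real.log_le_log (by positivity) (by gcongr)
  have hNQ : C * Q * (1 + Real.log (1 / δ)) ≤ (∑ t, sampleRule ν c Nmin t : ℕ) :=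
    le_trans (by gcongr) hN
  have hN4 : (4 : ℝ) * (T * Nmin) ≤ (∑ t, sampleRule ν c Nmin t : ℕ) := by
    calc (4 : ℝ) * (T * Nmin) ≤ C * Q := by
          gcongr
          linarith
      _ ≤ C * Q * (1 + Real.log (1 / δ)) := le_mul_of_one_le_right (by positivity) (by linarith)
      _ ≤ _ := hNQ
  have hNpos : (0 : ℝ) < (∑ t, sampleRule ν c Nmin t : ℕ) := by linarith
  have hrule : ∀ t, Nmin ≤ sampleRule ν c Nmin t := fun t => le_max_right _ _
  have hn0 : ∀ t, 0 < sampleRule ν c Nmin t := fun t =>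
    lt_of_lt_of_le (by exact_mod_cast hNmin0) (hrule t)
  have hA : ∑ t, ν t ^ 2 / (sampleRule ν c Nmin t : ℝ) ≤
      2 * l1norm ν ^ 2 / (∑ t, sampleRule ν c Nmin t : ℕ) := by
    rw [le_div_iff₀ hNpos]
    exact sum_sq_div_sampleRule_le ν hc (by exact_mod_cast hNmin0) hN4
  have hlog4 : Real.log (4 / δ) ≤ 2 + Real.log (1 / δ) := by
    rw [show 4 / δ = 2 * (2 * (1 / δ)) by ring, Real.log_mul (by norm_num) (by positivity),
      Real.log_mul (by norm_num) (by positivity)]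
    linarith [Real.log_two_lt_d9]
  have hlog4' : 0 ≤ Real.log (4 / δ) := Real.log_nonneg (by rw [le_div_iff₀ hδ]; linarith)
  refine le_trans (measure_mono fun ω hω => ?_) (hgood d k T m (sampleRule ν c Nmin) ρ M δ Bhat hρ hσ
    ((hk.trans hkT).trans hTd.le) (hk.trans hkT) hk hM hδ hδ1.le hl.measurable_rep (fun t => ?_) hn0
    ?_ hm0')
  · rintro ⟨hS, hD⟩
    refine hω ?_
    refine (excessRisk_le_of_good hn0 hm0' ha hb M hM.target hν hl (by positivity) (by positivity)
      hS hD hA).trans ?_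
    refine le_trans ?_ (risk_bound_arith (C := C) (s := (M.σ : ℝ) ^ 2) (ε := ε) (l := Real.log (1 / δ))
      (ℓ := l1norm ν) ha hb hCpos hd' hk' hT' hNpos (by positivity) hm0 hε hl1 (by linarith) hQdef
      hNQ hm2)
    gcongr
  · refine le_trans ?_ (hNmin.trans (by exact_mod_cast hrule t))
    gcongr
    linarith
  · refine le_trans ?_ hm1
    gcongr
    linarith

theorem mainTheorem4 :
    -- the optimal allocation for a fixed relevance vector
    (∀ (T : ℕ) (ν : Fin T → ℝ), ν ≠ 0 → ∀ Nmin N : ℝ, 0 < Nmin → T * Nmin ≤ N →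
      (∃ r, IsOptimalAllocation ν Nmin N r) ∧
      ∀ r, IsOptimalAllocation ν Nmin N r ↔
        ∃ c : ℝ, 0 < c ∧ (∀ t, r t = max (c * |ν t|) Nmin) ∧ ∑ t, r t = N) ∧
    -- sample complexity
    (∀ a b : ℝ, 0 < a → a ≤ b → ∃ C : ℝ, 0 < C ∧
      ∀ (d k T : ℕ), 1 ≤ k → k ≤ T → T < d →
      ∀ (ρ : NNReal), 1 ≤ ρ →
      ∀ (M : MTLModel d k T), M.Admissible a b ρ →
      ∀ (ν : Fin T → ℝ), M.W *ᵥ ν = M.wTarget →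
      ∀ (δ ε : ℝ), 0 < δ → δ < 1 → 0 < ε →
      ∀ (Nmin : ℕ), C * (ρ : ℝ) ^ 4 * (d + Real.log (T / δ)) ≤ Nmin →
      ε ^ 2 ≤ min 1 ((M.σ : ℝ) ^ 2 * (k * d + k * T) * l1norm ν ^ 2 / (T * Nmin)) →
      ∀ (c : ℝ), 0 < c →
      C * sourceSize d k M.σ ν ε * (1 + Real.log (sourceSize d k M.σ ν ε / δ)) ≤
        (∑ t, sampleRule ν c Nmin t : ℕ) →
      ∀ (m : ℕ), C * (ρ : ℝ) ^ 4 * (k + Real.log (1 / δ)) ≤ m →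
      C * ((M.σ : ℝ) ^ 2 * k / ε ^ 2) * (1 + Real.log (1 / δ)) ≤ m →
      ∀ (Bhat : SourceData d (sampleRule ν c Nmin) → Matrix (Fin d) (Fin k) ℝ)
        (What : SourceData d (sampleRule ν c Nmin) → Matrix (Fin k) (Fin T) ℝ)
        (what : SourceData d (sampleRule ν c Nmin) → TargetData d m → Fin k → ℝ),
        IsTransferLearner (sampleRule ν c Nmin) m Bhat What what →
        M.dataLaw (sampleRule ν c Nmin) m
          {ω | ¬ M.excessRisk (Bhat ω.1) (what ω.1 ω.2) ≤ ε ^ 2} ≤ ENNReal.ofReal δ) ∧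
    -- comparison with the quantity governing the `L2` strategy
    (∀ (T : ℕ) (ν : Fin T → ℝ) (N : ℝ), T ≤ N →
      l1norm ν ^ 2 ≤ 4 * (approxSparsity ν N * ∑ t, ν t ^ 2) ∧ approxSparsity ν N ≤ T) ∧
    (∀ (K : ℝ) (Nmin : ℕ), ∃ (T : ℕ) (ν : Fin T → ℝ) (N : ℝ), ν ≠ 0 ∧ T ≤ N ∧ T * Nmin ≤ N ∧
      K * l1norm ν ^ 2 ≤ approxSparsity ν N * ∑ t, ν t ^ 2) := by
  exact ⟨optimalAllocation_characterization, sample_complexity, l1norm_sq_le_approxSparsity,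
    exists_approxSparsity_gap⟩
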